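/- **Conventions.** Let $(X,\{R_i\}_{i=0}^D)$ be a symmetric association scheme on a finite set $X$: the $R_i$ are non-empty symmetric relations that partition $X\times X$, $R_0$ is the diagonal, and for $(x,y)\in R_k$ the number $p_{ij}^k=|\{w:(x,w)\in R_i,(w,y)\in R_j\}|$ depends only on $i,j,k$. Let $A_i$ be the adjacency matrix of $R_i$, and let $E_0=|X|^{-1}J,E_1,\dots,E_D$ be an ordering of the primitive idempotents of $\mathrm{span}(A_0,\dots,A_D)$. The second eigenmatrix $Q=(Q_{ij})$ and the Krein numbers $q_{ij}^k$ are defined by $|X|E_j=\sum_i Q_{ij}A_i$ and $E_i\circ E_j=|X|^{-1}\sum_k q_{ij}^kE_k$, where $\circ$ is the entrywise product. Put $B_i=(p_{ij}^k)_{j,k}$, $B_i^*=(q_{ij}^k)_{j,k}$ (row $j$, column $k$), $a_i^*=q_{1,i}^i$, $b_i^*=q_{1,i+1}^i$ for $0\le i<D$, and $c_i^*=q_{1,i-1}^i$ for $1\le i\le D$. With respect to the ordering, the scheme is *$Q$-polynomial* if for each $i$ there is a real polynomial $v_i^*$ of degree $i$ with $Q_{li}=v_i^*(Q_{l1})$ for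 all $l$; *$Q$-bipartite* if $a_i^*=0$ for all $i$; *$Q$-antipodal* if $b_i^*=c_{D-i}^*$ for all $0\le i<D$ with $i\ne\lfloor D/2\rfloor$. The *$Q$-antipodal classes* are the classes of the equivalence relation "the rows of $E_D$ at $x$ and $y$ coincide". For $z\in X$ put $R_j(z)=\{y\in X:(z,y)\in R_j\}$. **Lemma 4.1.** Let $(X,\{R_i\}_{i=0}^4)$ be a symmetric association scheme that is $Q$-polynomial, $Q$-antipodal and $Q$-bipartite with respect to an ordering $E_0,\dots,E_4$ of its primitive idempotents, with its relations numbered so that $Q_{01}>Q_{11}>Q_{21}>Q_{31}>Q_{41}$, and with exactly $f$ $Q$-antipodal classes, each of size $2d$. Assume $f\ge 3$. Then for every $z\in X$ and $j\in\{1,3\}$, $\bigl(R_j(z),\{R_i\cap(R_j(z)\times R_j(z))\}_{i=0}^3\bigr)$ is a symmetric association scheme with $3$ classes, and its primitive idempotents can be ordered so that it is $Q$-polynomial and $Q$-antipodal with exactly $f-1$ $Q$-antipodal classes, each of size $d$, and so that $$a_1^*=\frac{d}{f-1}-2.$$ Moreover its intersection matrices are $$B_1=\begin{pmatrix}0&1&0&0\\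 \frac{(f-2)(d+\sqrt d)}{2}&\frac{(f-3)(d+3\sqrt d)}{4}&\frac{(f-2)(d+2\sqrt d)}{4}&\frac{(f-3)(d+\sqrt d)}{4}\\ 0&\frac{d+\sqrt d-2}{2}&0&\frac{d+\sqrt d}{2}\\ 0&\frac{(f-3)(d-\sqrt d)}{4}&\frac{(f-2)d}{4}&\frac{(f-3)(d+\sqrt d)}{4}\end{pmatrix},$$ $$B_2=\begin{pmatrix}0&0&1&0\\ 0&\frac{d+\sqrt d-2}{2}&0&\frac{d+\sqrt d}{2}\\ d-1&0&d-2&0\\ 0&\frac{d-\sqrt d}{2}&0&\frac{d-\sqrt d-2}{2}\end{pmatrix},$$ $$B_3=\begin{pmatrix}0&0&0&1\\ 0&\frac{(f-3)(d-\sqrt d)}{4}&\frac{(f-2)d}{4}&\frac{(f-3)(d+\sqrt d)}{4}\\ 0&\frac{d-\sqrt d}{2}&0&\frac{d-\sqrt d-2}{2}\\ \frac{(f-2)(d-\sqrt d)}{2}&\frac{(f-3)(d-\sqrt d)}{4}&\frac{(f-2)(d-2\sqrt d)}{4}&\frac{(f-3)(d-3\sqrt d)}{4}\end{pmatrix},$$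 and, for the same ordering of the idempotents, its second eigenmatrix and its first Krein matrix are $$Q=\begin{pmatrix}1&d-1&(f-2)(d-1)&f-2\\ 1&\sqrt d-1&-\sqrt d+1&-1\\ 1&-1&-f+2&f-2\\ 1&-\sqrt d-1&\sqrt d+1&-1\end{pmatrix},\qquad B_1^*=\begin{pmatrix}0&1&0&0\\ d-1&\frac{d}{f-1}-2&\frac{d}{f-1}&0\\ 0&\frac{(f-2)d}{f-1}&\frac{(f-2)d}{f-1}-2&d-1\\ 0&0&1&0\end{pmatrix}.$$ -/

import Mathlib

/-- A symmetric association scheme with `D` classes on `X`: relations `R 0, …, R D` partitioning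
`X × X`, all non-empty, with `R 0` the diagonal and every `R i` symmetric, and with
intersection numbers `p i j k` (that is, $p_{ij}^k$). -/
structure AssocScheme (X : Type*) (D : ℕ) where
  R : Fin (D + 1) → X → X → Prop
  diag : ∀ x y, R 0 x y ↔ x = y
  partition : ∀ x y, ∃! i, R i x y
  nonempty : ∀ i, ∃ x y, R i x y
  symm : ∀ i x y, R i x y → R i y x
  p : Fin (D + 1) → Fin (D + 1) → Fin (D + 1) → ℕ
  regular : ∀ i j k x y, R k x y → {w | R i x w ∧ R j w y}.ncard = p i j k

namespace AssocScheme

variable {X : Type*} {D : ℕ}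

open Classical in
/-- The adjacency matrix of the relation `R i`. -/
noncomputable def A (S : AssocScheme X D) (i : Fin (D + 1)) : Matrix X X ℝ :=
  Matrix.of fun x y => if S.R i x y then 1 else 0

/-- The Bose–Mesner algebra, as a space of matrices: the linear span of the adjacency matrices. -/
noncomputable def boseMesner (S : AssocScheme X D) : Submodule ℝ (Matrix X X ℝ) :=
  Submodule.span ℝ (Set.range S.A)

/-- The intersection matrix `B i`, with `(j, k)` entry $p_{ij}^k$. -/
def intersectionMatrix (S : AssocScheme X D) (i : Fin (D + 1)) :
    Matrix (Fin (D + 1)) (Fin (D + 1)) ℝ :=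
  Matrix.of fun j k => (S.p i j k : ℝ)

/-- The subconstituent `R_j(z)`, as a type. -/
def Subconstituent (S : AssocScheme X D) (j : Fin (D + 1)) (z : X) : Type _ :=
  {y : X // S.R j z y}

noncomputable instance [Fintype X] (S : AssocScheme X D) (j : Fin (D + 1)) (z : X) :
    Fintype (S.Subconstituent j z) :=
  haveI : Finite (S.Subconstituent j z) := inferInstanceAs (Finite {y : X // S.R j z y})
  Fintype.ofFinite _

/-- An ordering `E 0, …, E D` of the primitive idempotents of the Bose–Mesner algebra with
`E 0 = |X|⁻¹ J`. (The algebra has dimension `D + 1`, so `D + 1` non-zero pairwise orthogonal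
idempotents in it are exactly its primitive idempotents.) -/
structure Idempotents [Fintype X] (S : AssocScheme X D) where
  E : Fin (D + 1) → Matrix X X ℝ
  mem : ∀ i, E i ∈ S.boseMesner
  zero : E 0 = Matrix.of fun _ _ => (Fintype.card X : ℝ)⁻¹
  ne_zero : ∀ i, E i ≠ 0
  idem : ∀ i, E i * E i = E i
  orthogonal : ∀ i j, i ≠ j → E i * E j = 0

theorem hadamard_mem (S : AssocScheme X D) {M N : Matrix X X ℝ}
    (hM : M ∈ S.boseMesner) (hN : N ∈ S.boseMesner) : M.hadamard N ∈ S.boseMesner := by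
  unfold boseMesner at hM hN ⊢
  induction hM using Submodule.span_induction with
  | zero => simp
  | add a b _ _ ha hb => rw [Matrix.add_hadamard]; exact add_mem ha hb
  | smul c a _ ha => rw [Matrix.smul_hadamard]; exact Submodule.smul_mem _ c ha
  | mem a ha =>
    obtain ⟨i, rfl⟩ := ha
    induction hN using Submodule.span_induction with
    | zero => simp
    | add a b _ _ ha hb => rw [Matrix.hadamard_add]; exact add_mem ha hb
    | smul c a _ ha => rw [Matrix.hadamard_smul]; exact Submodule.smul_mem _ c ha
    | mem b hb =>
      obtain ⟨j, rfl⟩ := hb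
      by_cases hij : i = j
      · subst hij
        have h : (S.A i).hadamard (S.A i) = S.A i := by
          ext x y; simp [A, Matrix.hadamard]
        rw [h]
        exact Submodule.subset_span ⟨i, rfl⟩
      · have h : (S.A i).hadamard (S.A j) = 0 := by
          ext x y
          have := S.partition x y
          simp only [A, Matrix.hadamard, Matrix.of_apply, Matrix.zero_apply]
          by_cases h1 : S.R i x y
          · by_cases h2 : S.R j x y
            · exact absurd (this.unique h1 h2) hij
            · simp [h2]
          · simp [h1]
        rw [h]
        exact zero_mem _

namespace Idempotents

variable [Fintype X] {S : AssocScheme X D}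

theorem exists_eigenmatrix (I : S.Idempotents) (j : Fin (D + 1)) :
    ∃ c : Fin (D + 1) → ℝ, (Fintype.card X : ℝ) • I.E j = ∑ i, c i • S.A i := by
  have h := Submodule.smul_mem _ (Fintype.card X : ℝ) (I.mem j)
  obtain ⟨c, hc⟩ := (Submodule.mem_span_range_iff_exists_fun ℝ).1 h
  exact ⟨c, hc.symm⟩

/-- The second eigenmatrix: `|X| E j = ∑ i, Q i j • A i`. -/
noncomputable def Q (I : S.Idempotents) : Matrix (Fin (D + 1)) (Fin (D + 1)) ℝ :=
  Matrix.of fun i j => Classical.choose (I.exists_eigenmatrix j) i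

theorem Q_spec (I : S.Idempotents) (j : Fin (D + 1)) :
    (Fintype.card X : ℝ) • I.E j = ∑ i, I.Q i j • S.A i :=
  Classical.choose_spec (I.exists_eigenmatrix j)

theorem linearIndependent (I : S.Idempotents) : LinearIndependent ℝ I.E := by
  rw [Fintype.linearIndependent_iff]
  intro g hg i
  have h := congrArg (fun M => M * I.E i) hg
  simp only [Finset.sum_mul, zero_mul, Matrix.smul_mul] at h
  rw [Finset.sum_eq_single i] at h
  · rw [I.idem] at h
    exact (smul_eq_zero.1 h).resolve_right (I.ne_zero i)
  · intro b _ hb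
    rw [I.orthogonal b i hb, smul_zero]
  · simp

theorem span_eq (I : S.Idempotents) : Submodule.span ℝ (Set.range I.E) = S.boseMesner := by
  apply Submodule.eq_of_le_of_finrank_le
  · rw [Submodule.span_le]
    rintro _ ⟨i, rfl⟩
    exact I.mem i
  · rw [finrank_span_eq_card I.linearIndependent]
    exact finrank_range_le_card S.A

theorem exists_krein (I : S.Idempotents) (i j : Fin (D + 1)) :
    ∃ c : Fin (D + 1) → ℝ,
      (I.E i).hadamard (I.E j) = (Fintype.card X : ℝ)⁻¹ • ∑ k, c k • I.E k := by
  have h := Submodule.smul_mem _ (Fintype.card X : ℝ) (S.hadamard_mem (I.mem i) (I.mem j))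
  rw [← I.span_eq] at h
  obtain ⟨c, hc⟩ := (Submodule.mem_span_range_iff_exists_fun ℝ).1 h
  refine ⟨c, ?_⟩
  obtain ⟨x, -⟩ := S.nonempty 0
  have hX : (Fintype.card X : ℝ) ≠ 0 := by
    have : Nonempty X := ⟨x⟩
    exact_mod_cast Fintype.card_ne_zero
  rw [hc, smul_smul, inv_mul_cancel₀ hX, one_smul]

/-- The Krein numbers `q i j k`, that is $q_{ij}^k$:
`E i ∘ E j = |X|⁻¹ ∑ k, q i j k • E k` for the entrywise product `∘`. -/
noncomputable def q (I : S.Idempotents) (i j k : Fin (D + 1)) : ℝ :=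
  Classical.choose (I.exists_krein i j) k

theorem q_spec (I : S.Idempotents) (i j : Fin (D + 1)) :
    (I.E i).hadamard (I.E j) = (Fintype.card X : ℝ)⁻¹ • ∑ k, I.q i j k • I.E k :=
  Classical.choose_spec (I.exists_krein i j)

/-- The Krein matrix `B* i`, with `(j, k)` entry $q_{ij}^k$. -/
noncomputable def kreinMatrix (I : S.Idempotents) (i : Fin (D + 1)) :
    Matrix (Fin (D + 1)) (Fin (D + 1)) ℝ :=
  Matrix.of fun j k => I.q i j k

/-- $a_i^* = q_{1,i}^i$. -/
noncomputable def aStar (I : S.Idempotents) (i : Fin (D + 1)) : ℝ := I.q 1 i i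

/-- $b_i^* = q_{1,i+1}^i$ for `0 ≤ i < D`. -/
noncomputable def bStar (I : S.Idempotents) (i : Fin D) : ℝ := I.q 1 i.succ i.castSucc

/-- `cStar i` is $c_{i+1}^* = q_{1,i}^{i+1}$ for `0 ≤ i < D`. -/
noncomputable def cStar (I : S.Idempotents) (i : Fin D) : ℝ := I.q 1 i.castSucc i.succ

/-- The scheme is `Q`-polynomial with respect to the ordering `E 0, …, E D`: each `|X| E i` is,
for the entrywise product, a polynomial of degree `i` in `|X| E 1`. -/
def IsQPolynomial (I : S.Idempotents) : Prop :=
  ∀ i : Fin (D + 1), ∃ v : Polynomial ℝ, v.natDegree = (i : ℕ) ∧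
    ∀ l, I.Q l i = v.eval (I.Q l 1)

/-- `Q`-bipartite: all $a_i^*$ vanish. -/
def IsQBipartite (I : S.Idempotents) : Prop := ∀ i, I.aStar i = 0

/-- `Q`-antipodal: $b_i^* = c_{D-i}^*$ for all `i`, except possibly `i = ⌊D/2⌋`.
(`Fin.rev i` is `D - 1 - i`, so that `cStar i.rev` is $c_{D-i}^*$; the case `i = D` reads `0 = 0`.) -/
def IsQAntipodal (I : S.Idempotents) : Prop :=
  ∀ i : Fin D, (i : ℕ) ≠ D / 2 → I.bStar i = I.cStar i.rev

/-- The equivalence relation that belongs to the pair `{E 0, E D}`: `x` and `y` are equivalent when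
the rows of `E D` (equivalently of `E 0 + E D`) at `x` and `y` agree. In a `Q`-antipodal scheme its
classes are the `Q`-antipodal classes, and `E 0 + E D` is block diagonal along them,
with constant blocks. -/
def antipodalSetoid (I : S.Idempotents) : Setoid X :=
  Setoid.ker fun x => (fun y => I.E (Fin.last D) x y)

/-- There are exactly `f` antipodal classes, each of size `r`. -/
def HasAntipodalClasses (I : S.Idempotents) (f r : ℕ) : Prop :=
  I.antipodalSetoid.classes.ncard = f ∧ ∀ c ∈ I.antipodalSetoid.classes, c.ncard = r

end Idempotents

end AssocScheme

/-
Up to scaling, `E 1` is the Gram matrix `H` of `f` mutually unbiased frames in dimension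
`d = s ^ 2`, each consisting of the vectors `± v` for `v` in an orthogonal basis, and `E 0 + E 4`
is the indicator `K` of lying in the same frame: this is read off from the three-term
recurrence satisfied by the rows of `Q`. Since `x ↦ - x` exchanges `R 1` and `R 3`, one may take
`j = 1` after replacing `z` by a point `a`, and `R 1 a` then contains one vector from each pair
`± v` outside the frame of `a`: what remains are `f - 1` mutually unbiased orthogonal bases. Because
every single frame is tight, the products of the restrictions of `H` and `K` can be computed;
together with `1` and the all-ones matrix `J` they span an algebra of dimension 4, whose
idempotents and eigenmatrices are explicit, and all the parameters follow.
-/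

namespace AssocScheme

section GramMatrix

variable {X R : Type*} [Fintype X] [CommRing R] {P : Matrix X X R} {c : R}

lemma sum_sq_row_combination (hP : P.IsSymm) (hPP : P * P = c • P) (x y : X) (a b : R) :
    ∑ w, (a * P x w + b * P y w) ^ 2 =
      c * (a ^ 2 * P x x + 2 * a * b * P x y + b ^ 2 * P y y) := by
  have hrows (x y : X) : ∑ w, P x w * P y w = c * P x y := by
    simpa [Matrix.mul_apply, hP.apply] using congr_fun₂ hPP x y
  calc ∑ w, (a * P x w + b * P y w) ^ 2
      = a ^ 2 * ∑ w, P x w * P x w + 2 * a * b * ∑ w, P x w * P y w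
          + b ^ 2 * ∑ w, P y w * P y w := by
        simp only [Finset.mul_sum, ← Finset.sum_add_distrib]
        exact Finset.sum_congr rfl fun w _ => by ring
    _ = _ := by rw [hrows, hrows, hrows]; ring

variable [LinearOrder R] [IsStrictOrderedRing R]

lemma row_combination_eq_zero (hP : P.IsSymm) (hPP : P * P = c • P) {x y : X} {a b : R}
    (h : a ^ 2 * P x x + 2 * a * b * P x y + b ^ 2 * P y y = 0) (w : X) :
    a * P x w + b * P y w = 0 := by
  have hsum := sum_sq_row_combination hP hPP x y a b
  rw [h, mul_zero, Finset.sum_eq_zero_iff_of_nonneg fun _ _ => sq_nonneg _] at hsum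
  exact pow_eq_zero_iff two_ne_zero |>.1 (hsum w (Finset.mem_univ w))

lemma eq_zero_of_diag_eq_zero (hP : P.IsSymm) (hPP : P * P = c • P) (h : ∀ x, P x x = 0) :
    P = 0 := by
  ext x w
  simpa using row_combination_eq_zero hP hPP (x := x) (y := x) (a := 1) (b := 0) (by simp [h]) w

end GramMatrix

section Relations

variable {X : Type*} {D : ℕ}

open Classical in
lemma cast_ncard_setOf {R : Type*} [AddCommMonoidWithOne R] [Fintype X] (p : X → Prop) :
    ({x | p x}.ncard : R) = ∑ x, if p x then 1 else 0 := by
  rw [Set.ncard_eq_toFinset_card', Set.toFinset_ofPred, Finset.natCast_card_filter]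

lemma ncard_classes_mul [Fintype X] {r : Setoid X} {k : ℕ} (h : ∀ c ∈ r.classes, c.ncard = k) :
    r.classes.ncard * k = Fintype.card X := by
  have hpart := r.isPartition_classes.ncard_eq_finsum Set.univ
  simp only [Set.univ_inter, Set.ncard_univ, Nat.card_eq_fintype_card] at hpart
  have := Fintype.ofFinite r.classes
  rw [hpart, finsum_eq_sum_of_fintype,
    Finset.sum_congr rfl fun (t : r.classes) _ => h t.1 t.2, Finset.sum_const, Finset.card_univ,
    smul_eq_mul, ← Nat.card_eq_fintype_card, Nat.card_coe_set_eq]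

/-- The relations `R 0, …, R D` partition `X × X`, are symmetric, and `R 0` is the diagonal:
the part of the definition of a symmetric association scheme that passes to subsets of `X`. -/
structure IsSymmPartition (R : Fin (D + 1) → X → X → Prop) : Prop where
  diag : ∀ x y, R 0 x y ↔ x = y
  partition : ∀ x y, ∃! i, R i x y
  symm : ∀ i x y, R i x y → R i y x

open Classical in
/-- The `0`-`1` matrix of a relation; `S.A i` is `relMatrix (S.R i)` by definition. -/
noncomputable def relMatrix (r : X → X → Prop) : Matrix X X ℝ :=
  Matrix.of fun x y => if r x y then 1 else 0

lemma cast_ncard_class_of_relMatrix_mul [Fintype X] {r : Setoid X} {c : ℝ}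
    (h : relMatrix r * relMatrix r = c • relMatrix r) (x : X) : ({y | r y x}.ncard : ℝ) = c := by
  have hdiag := congr_fun₂ h x x
  simp only [relMatrix, Matrix.mul_apply, Matrix.smul_apply, Matrix.of_apply, r.refl' x, if_true,
    smul_eq_mul, mul_one] at hdiag
  rw [cast_ncard_setOf, ← hdiag]
  refine Finset.sum_congr rfl fun y _ => ?_
  by_cases hy : r y x
  · simp [hy, r.symm' hy]
  · simp [hy]

namespace IsSymmPartition

variable {R : Fin (D + 1) → X → X → Prop} (hR : IsSymmPartition R)
include hR

lemma unique {i j : Fin (D + 1)} {x y : X} (hi : R i x y) (hj : R j x y) : i = j :=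
  (hR.partition x y).unique hi hj

lemma relMatrix_zero [DecidableEq X] : relMatrix (R 0) = 1 := by
  ext x y
  simp [relMatrix, Matrix.one_apply, hR.diag]

lemma relMatrix_apply (i : Fin (D + 1)) {l : Fin (D + 1)} {x y : X} (h : R l x y) :
    relMatrix (R i) x y = if i = l then 1 else 0 := by
  have : R i x y ↔ i = l := ⟨fun hi => hR.unique hi h, fun hi => hi ▸ h⟩
  simp [relMatrix, this]

lemma isSymm_of_apply {M : Matrix X X ℝ} {v : Fin (D + 1) → ℝ}
    (hM : ∀ {l x y}, R l x y → M x y = v l) : M.IsSymm := Matrix.IsSymm.ext fun x y => by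
  obtain ⟨l, hl, -⟩ := hR.partition x y
  rw [hM hl, hM (hR.symm _ _ _ hl)]

lemma sum_smul_relMatrix_apply (c : Fin (D + 1) → ℝ) {l : Fin (D + 1)} {x y : X} (h : R l x y) :
    (∑ i, c i • relMatrix (R i)) x y = c l := by
  simp [Matrix.sum_apply, hR.relMatrix_apply _ h]

end IsSymmPartition

lemma isSymmPartition (S : AssocScheme X D) : IsSymmPartition S.R := ⟨S.diag, S.partition, S.symm⟩

lemma rel_zero_self (S : AssocScheme X D) (x : X) : S.R 0 x x := (S.diag x x).2 rfl

lemma card_pos (S : AssocScheme X D) [Fintype X] : 0 < (Fintype.card X : ℝ) := by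
  obtain ⟨x, -⟩ := S.nonempty 0
  have : Nonempty X := ⟨x⟩
  exact_mod_cast Fintype.card_pos

lemma exists_rel (S : AssocScheme X D) [Finite X] (i : Fin (D + 1)) (x : X) : ∃ y, S.R i x y := by
  obtain ⟨x₀, y₀, h₀⟩ := S.nonempty i
  have hp : S.p i i 0 ≠ 0 := by
    rw [← S.regular i i 0 x₀ x₀ (S.rel_zero_self x₀)]
    exact Set.ncard_ne_zero_of_mem (a := y₀) ⟨h₀, S.symm _ _ _ h₀⟩
  rw [← S.regular i i 0 x x (S.rel_zero_self x)] at hp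
  obtain ⟨y, hy, -⟩ := Set.nonempty_of_ncard_ne_zero hp
  exact ⟨y, hy⟩

lemma isSymm_of_mem_boseMesner (S : AssocScheme X D) {M : Matrix X X ℝ}
    (hM : M ∈ S.boseMesner) : M.IsSymm := by
  obtain ⟨c, rfl⟩ := (Submodule.mem_span_range_iff_exists_fun ℝ).1 hM
  exact S.isSymmPartition.isSymm_of_apply (S.isSymmPartition.sum_smul_relMatrix_apply c)

end Relations

namespace Idempotents

variable {X : Type*} [Fintype X] {D : ℕ} {S : AssocScheme X D} (I : S.Idempotents)

lemma E_isSymm (j : Fin (D + 1)) : (I.E j).IsSymm := S.isSymm_of_mem_boseMesner (I.mem j)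

lemma E_mul_E (i j : Fin (D + 1)) : I.E i * I.E j = if i = j then I.E j else 0 := by
  split_ifs with h
  · rw [h, I.idem]
  · exact I.orthogonal i j h

lemma card_mul_E {l : Fin (D + 1)} {x y : X} (h : S.R l x y) (j : Fin (D + 1)) :
    (Fintype.card X : ℝ) * I.E j x y = I.Q l j :=
  (congr_fun₂ (I.Q_spec j) x y).trans
    (S.isSymmPartition.sum_smul_relMatrix_apply (fun i => I.Q i j) h)

lemma E_apply {l : Fin (D + 1)} {x y : X} (h : S.R l x y) (j : Fin (D + 1)) :
    I.E j x y = (Fintype.card X : ℝ)⁻¹ * I.Q l j := by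
  rw [← I.card_mul_E h j, inv_mul_cancel_left₀ S.card_pos.ne']

lemma Q_zero_right (l : Fin (D + 1)) : I.Q l 0 = 1 := by
  obtain ⟨x, y, hl⟩ := S.nonempty l
  rw [← I.card_mul_E hl, I.zero, Matrix.of_apply, mul_inv_cancel₀ S.card_pos.ne']

lemma eq_of_forall_sum_mul_Q_eq {c c' : Fin (D + 1) → ℝ}
    (h : ∀ l, ∑ k, c k * I.Q l k = ∑ k, c' k * I.Q l k) : c = c' := by
  refine I.linearIndependent.fintypeLinearCombination_injective ?_
  ext x y
  obtain ⟨l, hl, -⟩ := S.partition x y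
  simp only [Fintype.linearCombination_apply, Matrix.sum_apply, Matrix.smul_apply, I.E_apply hl,
    smul_eq_mul, mul_left_comm _ (Fintype.card X : ℝ)⁻¹, ← Finset.mul_sum, h]

lemma Q_mul_Q (l i j : Fin (D + 1)) : I.Q l i * I.Q l j = ∑ k, I.q i j k * I.Q l k := by
  obtain ⟨x, y, hl⟩ := S.nonempty l
  have h := congr_fun₂ (I.q_spec i j) x y
  simp only [Matrix.smul_apply, Matrix.hadamard_apply, Matrix.sum_apply, I.E_apply hl, smul_eq_mul,
    mul_left_comm _ (Fintype.card X : ℝ)⁻¹, ← Finset.mul_sum, mul_assoc] at h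
  have hn := inv_ne_zero S.card_pos.ne'
  exact mul_left_cancel₀ hn (mul_left_cancel₀ hn (by linear_combination h))

lemma q_unique {c : Fin (D + 1) → ℝ} {i j : Fin (D + 1)}
    (h : ∀ l, I.Q l i * I.Q l j = ∑ k, c k * I.Q l k) : I.q i j = c :=
  I.eq_of_forall_sum_mul_Q_eq fun l => (I.Q_mul_Q l i j).symm.trans (h l)

lemma q_zero_right (i k : Fin (D + 1)) : I.q i 0 k = if k = i then 1 else 0 :=
  congr_fun (I.q_unique (c := fun k => if k = i then 1 else 0) (by simp [I.Q_zero_right])) k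

lemma sum_E [DecidableEq X] : ∑ k, I.E k = 1 := by
  have hone : (1 : Matrix X X ℝ) ∈ Submodule.span ℝ (Set.range I.E) :=
    I.span_eq ▸ Submodule.subset_span ⟨0, S.isSymmPartition.relMatrix_zero⟩
  obtain ⟨c, hc⟩ := (Submodule.mem_span_range_iff_exists_fun ℝ).1 hone
  have hcoeff (k) : c k • I.E k = I.E k := by
    simpa [Finset.sum_mul, I.E_mul_E] using congrArg (· * I.E k) hc
  simpa [hcoeff] using hc

lemma sum_Q (l : Fin (D + 1)) : ∑ k, I.Q l k = if l = 0 then (Fintype.card X : ℝ) else 0 := by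
  classical
  obtain ⟨x, y, hl⟩ := S.nonempty l
  have hxy : x = y ↔ l = 0 :=
    ⟨fun h => S.isSymmPartition.unique hl ((S.diag x y).2 h), fun h => (S.diag x y).1 (h ▸ hl)⟩
  rw [← Finset.sum_congr rfl fun k _ => I.card_mul_E hl k, ← Finset.mul_sum, ← Matrix.sum_apply,
    I.sum_E, Matrix.one_apply]
  simp [hxy]

lemma sum_q (i k : Fin (D + 1)) : ∑ j, I.q i j k = I.Q 0 i := by
  refine congr_fun (I.eq_of_forall_sum_mul_Q_eq (c := fun k => ∑ j, I.q i j k)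
    (c' := fun _ => I.Q 0 i) fun l => ?_) k
  calc ∑ k, (∑ j, I.q i j k) * I.Q l k = ∑ j, I.Q l i * I.Q l j := by
        simp only [I.Q_mul_Q, Finset.sum_mul]
        exact Finset.sum_comm
    _ = I.Q 0 i * ∑ k, I.Q l k := by
        rw [← Finset.mul_sum, I.sum_Q]
        split_ifs with h <;> simp [h]
    _ = _ := Finset.mul_sum ..

lemma Q_zero_pos (j : Fin (D + 1)) : 0 < I.Q 0 j := by
  have hPP : I.E j * I.E j = (1 : ℝ) • I.E j := by rw [one_smul, I.idem]
  have hdiag (x : X) : I.E j x x = (Fintype.card X : ℝ)⁻¹ * I.Q 0 j :=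
    I.E_apply (S.rel_zero_self x) j
  obtain ⟨x, -⟩ := S.nonempty 0
  have hsum := sum_sq_row_combination (I.E_isSymm j) hPP x x 1 0
  have hnonneg : 0 ≤ (Fintype.card X : ℝ)⁻¹ * I.Q 0 j := by
    rw [← hdiag x]
    calc 0 ≤ ∑ w, (1 * I.E j x w + 0 * I.E j x w) ^ 2 := Finset.sum_nonneg fun _ _ => sq_nonneg _
      _ = I.E j x x := by rw [hsum]; ring
  have hne : I.Q 0 j ≠ 0 := fun h =>
    I.ne_zero j <| eq_zero_of_diag_eq_zero (I.E_isSymm j) hPP fun x => by rw [hdiag, h, mul_zero]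
  exact (nonneg_of_mul_nonneg_right hnonneg (inv_pos.2 S.card_pos)).lt_of_ne' hne

lemma abs_Q_le (l j : Fin (D + 1)) : |I.Q l j| ≤ I.Q 0 j := by
  obtain ⟨x, y, hl⟩ := S.nonempty l
  have hPP : I.E j * I.E j = (1 : ℝ) • I.E j := by rw [one_smul, I.idem]
  have hsq (b : ℝ) (hb : b ^ 2 = 1) : 0 ≤ I.Q 0 j + b * I.Q l j := by
    have hsum := sum_sq_row_combination (I.E_isSymm j) hPP x y 1 b
    rw [I.E_apply (S.rel_zero_self x), I.E_apply (S.rel_zero_self y), I.E_apply hl, hb] at hsum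
    have hnonneg : 0 ≤ (Fintype.card X : ℝ)⁻¹ * (I.Q 0 j + b * I.Q l j) := by
      have : 0 ≤ ∑ w, (1 * I.E j x w + b * I.E j y w) ^ 2 :=
        Finset.sum_nonneg fun _ _ => sq_nonneg _
      linarith
    exact nonneg_of_mul_nonneg_right hnonneg (inv_pos.2 S.card_pos)
  exact abs_le.2 ⟨by linarith [hsq 1 (by norm_num)], by linarith [hsq (-1) (by norm_num)]⟩

lemma hadamard_mul_E (i j k : Fin (D + 1)) :
    (I.E i).hadamard (I.E j) * I.E k = ((Fintype.card X : ℝ)⁻¹ * I.q i j k) • I.E k := by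
  simp [I.q_spec, Finset.sum_mul, I.E_mul_E, smul_smul]

lemma q_mul_symm (i j k : Fin (D + 1)) : I.q i j k * I.Q 0 k = I.q i k j * I.Q 0 j := by
  obtain ⟨x, -⟩ := S.nonempty 0
  -- both sides are multiples of `∑ w, E i x w * E j x w * E k x w`
  have hswap : ((I.E i).hadamard (I.E j) * I.E k) x x =
      ((I.E i).hadamard (I.E k) * I.E j) x x := by
    simp only [Matrix.mul_apply, Matrix.hadamard_apply]
    exact Finset.sum_congr rfl fun w _ => by
      rw [(I.E_isSymm k).apply, (I.E_isSymm j).apply]; ring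
  simp only [I.hadamard_mul_E, Matrix.smul_apply, I.E_apply (S.rel_zero_self x), smul_eq_mul]
    at hswap
  have hn := inv_ne_zero S.card_pos.ne'
  exact mul_left_cancel₀ hn (mul_left_cancel₀ hn (by linear_combination hswap))

lemma q_eq_zero_symm {i j k : Fin (D + 1)} (h : I.q i j k = 0) : I.q i k j = 0 := by
  have := I.q_mul_symm i j k
  rw [h, zero_mul] at this
  exact (mul_eq_zero.1 this.symm).resolve_right (I.Q_zero_pos j).ne'

lemma antipodalSetoid_iff {l : Fin (D + 1)} {x y : X} (h : S.R l x y) :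
    I.antipodalSetoid x y ↔ I.Q l (Fin.last D) = I.Q 0 (Fin.last D) := by
  rw [← I.card_mul_E h, ← I.card_mul_E (S.rel_zero_self y)]
  refine ⟨fun hxy => congrArg _ (congr_fun hxy y), fun hxy => funext fun w => ?_⟩
  have hdiag : I.E (Fin.last D) x x = I.E (Fin.last D) y y := by
    rw [I.E_apply (S.rel_zero_self x), I.E_apply (S.rel_zero_self y)]
  have hrow := row_combination_eq_zero (I.E_isSymm (Fin.last D)) (c := 1)
    (by rw [one_smul, I.idem]) (x := x) (y := y) (a := 1) (b := -1)
    (by linear_combination hdiag - 2 * mul_left_cancel₀ S.card_pos.ne' hxy) w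
  linarith

end Idempotents

/-! ### `Q`-polynomial orderings and the first Krein matrix -/

section Polynomial

open Polynomial

variable {R : Type*} [CommRing R]

lemma degree_sum_C_mul_lt {ι : Type*} (s : Finset ι) (c : ι → R) {v : ι → R[X]} {N : ℕ}
    (h : ∀ i ∈ s, (v i).degree < N) : (∑ i ∈ s, C (c i) * v i).degree < N := by
  simp only [← smul_eq_C_mul, ← mem_degreeLT] at h ⊢
  exact Submodule.sum_mem _ fun i hi => Submodule.smul_mem _ _ (h i hi)

lemma degree_sum_C_mul [NoZeroDivisors R] {n : ℕ} {v : Fin n → R[X]}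
    (hdeg : ∀ i, (v i).degree = (i : ℕ)) (c : Fin n → R) :
    (∑ i, C (c i) * v i).degree =
      Finset.univ.sup fun i : Fin n => (C (c i)).degree + ((i : ℕ) : WithBot ℕ) := by
  have hterm (i) : (C (c i) * v i).degree = (C (c i)).degree + ((i : ℕ) : WithBot ℕ) := by
    rw [degree_mul, hdeg]
  have hterm' (i) (hi : C (c i) * v i ≠ 0) : (C (c i) * v i).degree = (i : ℕ) := by
    rw [hterm, degree_C (C_ne_zero.1 (left_ne_zero_of_mul hi)), zero_add]
  rw [degree_sum_eq_of_disjoint]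
  · simp only [hterm]
  · intro i hi i' hi' hne heq
    simp only [Function.comp_apply] at heq
    rw [hterm' i hi.2, hterm' i' hi'.2, Nat.cast_inj, Fin.val_inj] at heq
    exact hne heq

end Polynomial

namespace Idempotents

open Polynomial

variable {X : Type*} [Fintype X] {D : ℕ} {S : AssocScheme X D} {I : S.Idempotents}

lemma IsQPolynomial.exists_degree_eq (h : I.IsQPolynomial) :
    ∃ v : Fin (D + 1) → ℝ[X], (∀ i, (v i).degree = (i : ℕ)) ∧
      ∀ l i, I.Q l i = (v i).eval (I.Q l 1) := by
  choose v hdeg hv using h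
  refine ⟨v, fun i => ?_, fun l i => hv i l⟩
  have hne : v i ≠ 0 := fun h0 => (I.Q_zero_pos i).ne' (by rw [hv, h0, eval_zero])
  rw [degree_eq_natDegree hne, hdeg]

lemma X_mul_eq_sum_C_q_mul (hinj : Function.Injective fun l => I.Q l 1)
    {v : Fin (D + 1) → ℝ[X]} (hdeg : ∀ i, (v i).degree = (i : ℕ))
    (hv : ∀ l i, I.Q l i = (v i).eval (I.Q l 1)) (j : Fin D) :
    Polynomial.X * v j.castSucc = ∑ k, C (I.q 1 j.castSucc k) * v k := by
  have hlt (k : Fin (D + 1)) : ((k : ℕ) : WithBot ℕ) < (D + 1 : ℕ) := by exact_mod_cast k.2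
  refine eq_of_degrees_lt_of_eval_index_eq Finset.univ hinj.injOn ?_ ?_ fun l _ => ?_
  · rw [degree_mul, degree_X, hdeg, Finset.card_univ, Fintype.card_fin]
    have := hlt j.succ
    rwa [Fin.val_succ, Nat.cast_add, Nat.cast_one, add_comm] at this
  · rw [Finset.card_univ, Fintype.card_fin]
    exact degree_sum_C_mul_lt _ _ fun k _ => hdeg k ▸ hlt k
  · simp [eval_finsetSum, ← hv, I.Q_mul_Q]

lemma IsQPolynomial.sup_degree_q (h : I.IsQPolynomial)
    (hinj : Function.Injective fun l => I.Q l 1) (j : Fin D) :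
    (Finset.univ.sup fun k : Fin (D + 1) => (C (I.q 1 j.castSucc k)).degree + ((k : ℕ) : WithBot ℕ))
      = ((j : ℕ) + 1 : ℕ) := by
  obtain ⟨v, hdeg, hv⟩ := h.exists_degree_eq
  rw [← degree_sum_C_mul hdeg, ← X_mul_eq_sum_C_q_mul hinj hdeg hv, degree_mul, degree_X, hdeg,
    Fin.val_castSucc, Nat.cast_add, Nat.cast_one, add_comm]

lemma IsQPolynomial.q_eq_zero (h : I.IsQPolynomial)
    (hinj : Function.Injective fun l => I.Q l 1) {j k : Fin (D + 1)} (hjk : (j : ℕ) + 1 < k) :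
    I.q 1 j k = 0 := by
  by_contra hq
  have hle := Finset.le_sup (f := fun k : Fin (D + 1) =>
    (C (I.q 1 j k)).degree + ((k : ℕ) : WithBot ℕ)) (Finset.mem_univ k)
  have := h.sup_degree_q hinj ⟨j, by omega⟩
  simp only [Fin.castSucc_mk, Fin.eta] at this
  rw [this, degree_C hq, zero_add, Nat.cast_le] at hle
  omega

lemma IsQPolynomial.q_succ_ne_zero (h : I.IsQPolynomial)
    (hinj : Function.Injective fun l => I.Q l 1) (j : Fin D) : I.q 1 j.castSucc j.succ ≠ 0 := by
  obtain ⟨k, -, hk⟩ := Finset.exists_mem_eq_sup Finset.univ Finset.univ_nonempty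
    fun k : Fin (D + 1) => (C (I.q 1 j.castSucc k)).degree + ((k : ℕ) : WithBot ℕ)
  rw [h.sup_degree_q hinj] at hk
  have hq : I.q 1 j.castSucc k ≠ 0 := by
    intro hq
    simp [hq] at hk
  rw [degree_C hq, zero_add, Nat.cast_inj] at hk
  rwa [show j.succ = k from Fin.ext hk]

lemma Q_mul_Q_castSucc (I : S.Idempotents)
    (hzero : ∀ j k : Fin (D + 1), (j : ℕ) + 1 < k → I.q 1 j k = 0) (l : Fin (D + 1)) (j : Fin D) :
    I.Q l 1 * I.Q l j.castSucc = I.q 1 j.castSucc j.succ * I.Q l j.succ +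
      ∑ k ∈ Finset.Iio j.succ, I.q 1 j.castSucc k * I.Q l k := by
  rw [I.Q_mul_Q,
    ← Finset.sum_insert (f := fun k => I.q 1 j.castSucc k * I.Q l k) Finset.notMem_Iio_self,
    Finset.Iio_insert]
  refine (Finset.sum_subset (Finset.subset_univ _) fun k _ hk => ?_).symm
  rw [hzero _ _ (by simpa [Fin.lt_def] using hk), zero_mul]

lemma isQPolynomial_of_q (hzero : ∀ j k : Fin (D + 1), (j : ℕ) + 1 < k → I.q 1 j k = 0)
    (hne : ∀ j : Fin D, I.q 1 j.castSucc j.succ ≠ 0) : I.IsQPolynomial := by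
  suffices h : ∀ i : Fin (D + 1), ∃ v : ℝ[X], v.degree = (i : ℕ) ∧
      ∀ l, I.Q l i = v.eval (I.Q l 1) from
    fun i => (h i).imp fun v hv => ⟨natDegree_eq_of_degree_eq_some hv.1, hv.2⟩
  intro i
  induction i using WellFoundedLT.induction with | ind i ih
  cases i using Fin.cases with
  | zero => exact ⟨1, by simp, by simp [I.Q_zero_right]⟩
  | succ j =>
    choose! v hdeg hv using ih
    have hj : j.castSucc < j.succ := Fin.castSucc_lt_succ
    set c := I.q 1 j.castSucc
    have hc : c j.succ ≠ 0 := hne j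
    set w := ∑ k ∈ Finset.Iio j.succ, C (c k) * v k
    refine ⟨C (c j.succ)⁻¹ * (Polynomial.X * v j.castSucc - w), ?_, fun l => ?_⟩
    · have hX : (Polynomial.X * v j.castSucc).degree = ((j.succ : ℕ) : WithBot ℕ) := by
        rw [degree_mul, degree_X, hdeg _ hj, add_comm, Fin.val_succ, Nat.cast_add]
        rfl
      have hw : w.degree < (Polynomial.X * v j.castSucc).degree := by
        rw [hX]
        refine degree_sum_C_mul_lt _ _ fun k hk => ?_
        rw [hdeg k (Finset.mem_Iio.1 hk)]
        exact_mod_cast Finset.mem_Iio.1 hk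
      rw [degree_C_mul (inv_ne_zero hc), degree_sub_eq_left_of_degree_lt hw, hX]
    · have hweval : w.eval (I.Q l 1) = ∑ k ∈ Finset.Iio j.succ, c k * I.Q l k := by
        rw [eval_finsetSum]
        exact Finset.sum_congr rfl fun k hk => by
          rw [eval_mul, eval_C, ← hv k (Finset.mem_Iio.1 hk)]
      rw [eval_mul, eval_C, eval_sub, eval_mul, eval_X, ← hv _ hj, hweval,
        I.Q_mul_Q_castSucc hzero, add_sub_cancel_right, inv_mul_cancel_left₀ hc]

end Idempotents

/-! ### The eigenmatrix of a `Q`-antipodal `Q`-bipartite scheme with four classes -/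

lemma eq_of_strictAnti_of_forall_mem_range {n : ℕ} {α : Type*} [PartialOrder α] {f g : Fin n → α}
    (hf : StrictAnti f) (hg : StrictAnti g) (h : ∀ i, f i ∈ Set.range g) : f = g := by
  refine (hf.range_inj hg).1 (Set.eq_of_subset_of_ncard_le (Set.range_subset_iff.2 h) ?_)
  rw [Set.ncard_range_of_injective hf.injective, Set.ncard_range_of_injective hg.injective]

/-- The inner products, in the order of the relations, between vectors of squared norm `s` that
belong to a system of mutually unbiased orthogonal frames. -/
def gramValue (s : ℝ) : Fin 5 → ℝ := ![s, 1, 0, -1, -s]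

/-- The indicator of the relations that join vectors of the same frame. -/
def sameFrame : Fin 5 → ℝ := ![1, 0, 1, 0, 1]

lemma gramValue_strictAnti {s : ℝ} (hs : 1 < s) : StrictAnti (gramValue s) := by
  refine Fin.strictAnti_iff_succ_lt.2 fun i => ?_
  fin_cases i <;> simp [gramValue] <;> linarith

section Recurrence

-- the equations relate the entries `1, θ, v₂, v₃, v₄` of a row of `Q`, with `m = Q 0 1` and
-- `μ = q 1 1 2`, in a `Q`-antipodal `Q`-bipartite scheme with four classes
variable {F : Type*} [Field F] {m μ θ v₂ v₃ v₄ : F} (h₁ : θ * θ = m + μ * v₂)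
  (h₂ : θ * v₂ = (m - 1) * (θ + v₃)) (h₃ : θ * v₃ = (m - μ) * v₂ + m * v₄) (h₄ : θ * v₄ = v₃)
include h₁ h₂ h₃ h₄

lemma recurrence_factors : (v₂ = 0 ∨ μ * v₄ = m - μ) ∧ (θ = 0 ∨ v₂ = (m - 1) * (1 + v₄)) := by
  have h₂₄ : v₂ * (μ * v₄ - (m - μ)) = 0 := by linear_combination h₃ - v₄ * h₁ + θ * h₄
  have hθ : θ * (v₂ - (m - 1) * (1 + v₄)) = 0 := by linear_combination h₂ - (m - 1) * h₄
  exact ⟨(mul_eq_zero.1 h₂₄).imp_right sub_eq_zero.1, (mul_eq_zero.1 hθ).imp_right sub_eq_zero.1⟩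

lemma eigenvalue_of_recurrence : θ = 0 ∨ θ * θ = m ∨ θ * θ = m * m := by
  obtain ⟨h | h, hθ⟩ := recurrence_factors h₁ h₂ h₃ h₄
  · exact .inr (.inl (by rw [h₁, h, mul_zero, add_zero]))
  · exact hθ.imp_right fun h' => .inr (by linear_combination h₁ + μ * h' + (m - 1) * h)

open Classical in
lemma last_coeff_of_recurrence (hμ : μ ≠ 0) (hm₀ : m ≠ 0) (hm₁ : m ≠ 1) :
    v₄ = if θ * θ = m then -1 else m / μ - 1 := by
  obtain ⟨hv₂, hθ⟩ := recurrence_factors h₁ h₂ h₃ h₄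
  split_ifs with h
  · have hv₂ : v₂ = 0 := (mul_eq_zero.1 (by linear_combination h - h₁ : μ * v₂ = 0)).resolve_left hμ
    have hθ₀ : θ ≠ 0 := fun h₀ => hm₀ (by rw [← h, h₀, mul_zero])
    have hv₄ : (m - 1) * (1 + v₄) = 0 := (hθ.resolve_left hθ₀).symm.trans hv₂
    linear_combination (mul_eq_zero.1 hv₄).resolve_left (sub_ne_zero.2 hm₁)
  · have := hv₂.resolve_left fun h₀ => h (by rw [h₁, h₀, mul_zero, add_zero])
    field_simp
    linear_combination this

end Recurrence

namespace Idempotents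

variable {X : Type*} [Fintype X] {S : AssocScheme X 4} {I : S.Idempotents}

lemma IsQPolynomial.kreinMatrix_one_of_isQAntipodal_of_isQBipartite (hpoly : I.IsQPolynomial)
    (hanti : I.IsQAntipodal) (hbip : I.IsQBipartite)
    (hinj : Function.Injective fun l => I.Q l 1) :
    I.kreinMatrix 1 =
      !![0, 1, 0, 0, 0;
         I.Q 0 1, 0, I.q 1 1 2, 0, 0;
         0, I.Q 0 1 - 1, 0, I.Q 0 1 - 1, 0;
         0, 0, I.Q 0 1 - I.q 1 1 2, 0, I.Q 0 1;
         0, 0, 0, 1, 0] := by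
  have diag (i) : I.q 1 i i = 0 := hbip i
  have above {j k : Fin 5} (hjk : (j : ℕ) + 1 < k) : I.q 1 j k = 0 := hpoly.q_eq_zero hinj hjk
  have below {j k : Fin 5} (hkj : (k : ℕ) + 1 < j) : I.q 1 j k = 0 := I.q_eq_zero_symm (above hkj)
  have h01 : I.q 1 0 1 = 1 := by simp [I.q_zero_right]
  have colSum (k) : I.q 1 0 k + I.q 1 1 k + I.q 1 2 k + I.q 1 3 k + I.q 1 4 k = I.Q 0 1 :=
    (Fin.sum_univ_five fun j => I.q 1 j k).symm.trans (I.sum_q 1 k)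
  have h10 : I.q 1 1 0 = I.Q 0 1 := by
    simpa [diag, below (j := 2) (k := 0), below (j := 3) (k := 0), below (j := 4) (k := 0)]
      using colSum 0
  have h21 : I.q 1 2 1 = I.Q 0 1 - 1 := by
    linarith [colSum 1, diag 1, below (j := 3) (k := 1) (by decide),
      below (j := 4) (k := 1) (by decide)]
  have h32 : I.q 1 3 2 = I.Q 0 1 - I.q 1 1 2 := by
    linarith [colSum 2, diag 2, above (j := 0) (k := 2) (by decide),
      below (j := 4) (k := 2) (by decide)]
  have h23 : I.q 1 2 3 = I.Q 0 1 - 1 := (hanti 1 (by decide)).symm.trans h21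
  have h43 : I.q 1 4 3 = 1 := by
    linarith [colSum 3, diag 3, above (j := 0) (k := 3) (by decide),
      above (j := 1) (k := 3) (by decide)]
  have h34 : I.q 1 3 4 = I.Q 0 1 := by
    linarith [colSum 4, diag 4, above (j := 0) (k := 4) (by decide),
      above (j := 1) (k := 4) (by decide), above (j := 2) (k := 4) (by decide)]
  ext j k
  fin_cases j <;> fin_cases k <;>
    first
    | assumption
    | exact diag _
    | exact above (by decide)
    | exact below (by decide)
    | rfl

lemma IsQPolynomial.Q_recurrence (hpoly : I.IsQPolynomial) (hanti : I.IsQAntipodal)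
    (hbip : I.IsQBipartite) (hinj : Function.Injective fun l => I.Q l 1) (l : Fin 5) :
    I.Q l 1 * I.Q l 1 = I.Q 0 1 + I.q 1 1 2 * I.Q l 2 ∧
    I.Q l 1 * I.Q l 2 = (I.Q 0 1 - 1) * (I.Q l 1 + I.Q l 3) ∧
    I.Q l 1 * I.Q l 3 = (I.Q 0 1 - I.q 1 1 2) * I.Q l 2 + I.Q 0 1 * I.Q l 4 ∧
    I.Q l 1 * I.Q l 4 = I.Q l 3 := by
  have hB := hpoly.kreinMatrix_one_of_isQAntipodal_of_isQBipartite hanti hbip hinj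
  have hrow (j) : I.Q l 1 * I.Q l j = I.kreinMatrix 1 j 0 * I.Q l 0 + I.kreinMatrix 1 j 1 * I.Q l 1
      + I.kreinMatrix 1 j 2 * I.Q l 2 + I.kreinMatrix 1 j 3 * I.Q l 3
      + I.kreinMatrix 1 j 4 * I.Q l 4 := (I.Q_mul_Q l 1 j).trans (Fin.sum_univ_five _)
  refine ⟨(hrow 1).trans ?_, (hrow 2).trans ?_, (hrow 3).trans ?_, (hrow 4).trans ?_⟩ <;>
    simp [hB, I.Q_zero_right, mul_add]

lemma IsQPolynomial.Q_one_cases (hpoly : I.IsQPolynomial) (hanti : I.IsQAntipodal)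
    (hbip : I.IsQBipartite) (hinj : Function.Injective fun l => I.Q l 1) (l : Fin 5) :
    I.Q l 1 = 0 ∨ I.Q l 1 * I.Q l 1 = I.Q 0 1 ∨ I.Q l 1 * I.Q l 1 = I.Q 0 1 * I.Q 0 1 := by
  obtain ⟨h₁, h₂, h₃, h₄⟩ := hpoly.Q_recurrence hanti hbip hinj l
  exact eigenvalue_of_recurrence h₁ h₂ h₃ h₄

lemma IsQPolynomial.one_lt_Q_zero_one (hpoly : I.IsQPolynomial) (hanti : I.IsQAntipodal)
    (hbip : I.IsQBipartite) (hnat : StrictAnti fun l => I.Q l 1) : 1 < I.Q 0 1 := by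
  have hm := I.Q_zero_pos 1
  have h₂₁ : I.Q 2 1 < I.Q 1 1 := hnat (by decide)
  obtain ⟨l, hl₀, hl⟩ : ∃ l, I.Q l 1 ≠ 0 ∧ |I.Q l 1| < I.Q 0 1 := by
    have h₁₀ : I.Q 1 1 < I.Q 0 1 := hnat (by decide)
    have h₃₂ : I.Q 3 1 < I.Q 2 1 := hnat (by decide)
    have h₃ := (abs_le.1 (I.abs_Q_le 3 1)).1
    by_cases h₁ : I.Q 1 1 = 0
    · exact ⟨2, by linarith, abs_lt.2 ⟨by linarith, by linarith⟩⟩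
    · exact ⟨1, h₁, abs_lt.2 ⟨by linarith, by linarith⟩⟩
  have hlt : I.Q l 1 * I.Q l 1 < I.Q 0 1 * I.Q 0 1 := by
    rw [← abs_mul_abs_self]
    exact mul_self_lt_mul_self (abs_nonneg _) hl
  rcases hpoly.Q_one_cases hanti hbip hnat.injective l with h | h | h
  · exact absurd h hl₀
  · rw [h] at hlt
    exact (lt_mul_iff_one_lt_right hm).1 hlt
  · exact absurd h hlt.ne

lemma IsQPolynomial.exists_Q_one_eq_gramValue (hpoly : I.IsQPolynomial) (hanti : I.IsQAntipodal)
    (hbip : I.IsQBipartite) (hnat : StrictAnti fun l => I.Q l 1) :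
    ∃ s : ℝ, 1 < s ∧ ∀ l, I.Q l 1 = s * gramValue s l := by
  have hm := hpoly.one_lt_Q_zero_one hanti hbip hnat
  obtain ⟨s, hs, hsm⟩ : ∃ s : ℝ, 1 < s ∧ s * s = I.Q 0 1 :=
    ⟨√(I.Q 0 1), Real.lt_sqrt_of_sq_lt (by simpa using hm), Real.mul_self_sqrt (by linarith)⟩
  refine ⟨s, hs, congr_fun (eq_of_strictAnti_of_forall_mem_range hnat
    ((gramValue_strictAnti hs).const_mul (by linarith)) fun l => ?_)⟩
  rcases hpoly.Q_one_cases hanti hbip hnat.injective l with h | h | h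
  · exact ⟨2, by simp [gramValue, h]⟩
  · rw [← hsm] at h
    rcases mul_self_eq_mul_self_iff.1 h with h | h
    · exact ⟨1, by simp [gramValue, h]⟩
    · exact ⟨3, by simp [gramValue, h]⟩
  · rcases mul_self_eq_mul_self_iff.1 h with h | h
    · exact ⟨0, by simp [gramValue, h, hsm]⟩
    · exact ⟨4, by simp [gramValue, h, hsm]⟩

lemma IsQPolynomial.exists_Q_last_eq_sameFrame (hpoly : I.IsQPolynomial) (hanti : I.IsQAntipodal)
    (hbip : I.IsQBipartite) (hnat : StrictAnti fun l => I.Q l 1) :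
    ∃ F : ℝ, F ≠ 0 ∧ ∀ l, I.Q l 4 = F * sameFrame l - 1 := by
  obtain ⟨s, hs, hQ⟩ := hpoly.exists_Q_one_eq_gramValue hanti hbip hnat
  have hm := hpoly.one_lt_Q_zero_one hanti hbip hnat
  have hμ : I.q 1 1 2 ≠ 0 := hpoly.q_succ_ne_zero hnat.injective 1
  refine ⟨I.Q 0 1 / I.q 1 1 2, div_ne_zero (by linarith) hμ, fun l => ?_⟩
  obtain ⟨h₁, h₂, h₃, h₄⟩ := hpoly.Q_recurrence hanti hbip hnat.injective l
  rw [last_coeff_of_recurrence h₁ h₂ h₃ h₄ hμ (by linarith) hm.ne', hQ, hQ]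
  have hs₀ : s ≠ 0 := by linarith
  have hs₁ : s * s ≠ 1 := (one_lt_mul_of_lt_of_le hs hs.le).ne'
  fin_cases l <;> simp [gramValue, sameFrame, hs₀, hs₁]

end Idempotents

section AntipodalClasses

variable {X : Type*} [Fintype X] {D : ℕ} {S : AssocScheme X D} {I : S.Idempotents} {f r : ℕ}

lemma Idempotents.HasAntipodalClasses.ncard_class (h : I.HasAntipodalClasses f r) (x : X) :
    {y | I.antipodalSetoid y x}.ncard = r :=
  h.2 _ (I.antipodalSetoid.mem_classes x)

lemma Idempotents.HasAntipodalClasses.card_eq (h : I.HasAntipodalClasses f r) :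
    Fintype.card X = f * r := by
  rw [← ncard_classes_mul h.2, h.1]

lemma Idempotents.hasAntipodalClasses_of_ncard (hr : r ≠ 0)
    (h : ∀ x, {y | I.antipodalSetoid y x}.ncard = r) (hcard : Fintype.card X = f * r) :
    I.HasAntipodalClasses f r := by
  have hclass : ∀ c ∈ I.antipodalSetoid.classes, c.ncard = r := by
    rintro c ⟨x, rfl⟩
    exact h x
  exact ⟨Nat.eq_of_mul_eq_mul_right (Nat.pos_of_ne_zero hr)
    ((ncard_classes_mul hclass).trans hcard), hclass⟩

end AntipodalClasses

/-- `H` is the Gram matrix, with respect to the scheme `S`, of a system of `f` mutually unbiased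
frames in a space of dimension `d`, each frame consisting of the vectors `± v` for `v` in an
orthogonal basis: the vectors have squared norm `s`, and vectors of different frames have inner
product `± 1`. The matrix `K` indicates which vectors lie in the same frame. -/
structure IsFrameSystem {X : Type*} [Fintype X] (S : AssocScheme X 4) (f d : ℕ) (s : ℝ)
    (H K : Matrix X X ℝ) : Prop where
  one_lt : 1 < s
  gram_apply : ∀ {l x y}, S.R l x y → H x y = gramValue s l
  indicator_apply : ∀ {l x y}, S.R l x y → K x y = sameFrame l
  gram_mul : H * H = (Fintype.card X / s : ℝ) • H
  indicator_mul : K * K = (2 * d : ℝ) • K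
  card_eq : Fintype.card X = f * (2 * d)

section FrameSystem

variable {X : Type*} [Fintype X] {S : AssocScheme X 4} {I : S.Idempotents}

lemma Idempotents.relMatrix_antipodalSetoid_apply {F : ℝ} (hF : F ≠ 0)
    (hQ : ∀ l, I.Q l 4 = F * sameFrame l - 1) {l : Fin 5} {x y : X} (hl : S.R l x y) :
    relMatrix I.antipodalSetoid x y = sameFrame l := by
  have hiff : I.antipodalSetoid x y ↔ sameFrame l = sameFrame 0 := by
    rw [I.antipodalSetoid_iff hl, show Fin.last 4 = 4 from rfl, hQ, hQ, sub_left_inj,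
      mul_right_inj' hF]
  simp only [relMatrix, Matrix.of_apply, hiff]
  fin_cases l <;> simp [sameFrame]

lemma Idempotents.relMatrix_antipodalSetoid_eq_smul {F : ℝ} (hF : F ≠ 0)
    (hQ : ∀ l, I.Q l 4 = F * sameFrame l - 1) :
    relMatrix I.antipodalSetoid = (Fintype.card X / F : ℝ) • (I.E 0 + I.E 4) := by
  ext x y
  obtain ⟨l, hl, -⟩ := S.partition x y
  rw [relMatrix_antipodalSetoid_apply hF hQ hl, Matrix.smul_apply, Matrix.add_apply, smul_eq_mul,
    div_mul_eq_mul_div, mul_add, I.card_mul_E hl, I.card_mul_E hl, I.Q_zero_right, hQ,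
    add_sub_cancel, mul_div_cancel_left₀ _ hF]

lemma Idempotents.exists_isFrameSystem (hpoly : I.IsQPolynomial) (hanti : I.IsQAntipodal)
    (hbip : I.IsQBipartite) (hnat : StrictAnti fun l => I.Q l 1) {f d : ℕ}
    (hclasses : I.HasAntipodalClasses f (2 * d)) :
    ∃ s H K, IsFrameSystem S f d s H K := by
  obtain ⟨s, hs, hQ₁⟩ := hpoly.exists_Q_one_eq_gramValue hanti hbip hnat
  obtain ⟨F, hF, hQ₄⟩ := hpoly.exists_Q_last_eq_sameFrame hanti hbip hnat
  have hs₀ : s ≠ 0 := by linarith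
  set K : Matrix X X ℝ := relMatrix I.antipodalSetoid
  have hKK : K * K = (Fintype.card X / F : ℝ) • K := by
    have hK : K = _ := relMatrix_antipodalSetoid_eq_smul hF hQ₄
    simp [hK, mul_add, add_mul, I.E_mul_E, smul_smul]
  have hcard : (Fintype.card X / F : ℝ) = 2 * d := by
    obtain ⟨x, -⟩ := S.nonempty 0
    rw [← cast_ncard_class_of_relMatrix_mul hKK x, hclasses.ncard_class x]
    norm_cast
  refine ⟨s, (Fintype.card X / s : ℝ) • I.E 1, K, hs, fun {l x y} hl => ?_,
    relMatrix_antipodalSetoid_apply hF hQ₄, ?_, by rw [hKK, hcard], hclasses.card_eq⟩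
  · rw [Matrix.smul_apply, smul_eq_mul, div_mul_eq_mul_div, I.card_mul_E hl, hQ₁,
      mul_div_cancel_left₀ _ hs₀]
  · simp [I.E_mul_E, smul_smul]

end FrameSystem

/-! ### Mutually unbiased frames -/

lemma smul_sub_mul_self_of_mul_eq {R A : Type*} [CommRing R] [Ring A] [Algebra R A] {γ c : R}
    {u v : A} (huu : u * u = γ • u) (hv : v * (u * v * u) = c • (v * u)) :
    (c • u - u * v * u) * (c • u - u * v * u) = (c * γ) • (c • u - u * v * u) := by
  have hmid : u * v * u * (u * v * u) = (c * γ) • (u * v * u) := by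
    calc u * v * u * (u * v * u) = u * v * (u * u) * v * u := by simp only [mul_assoc]
      _ = γ • (u * (v * (u * v * u))) := by simp [huu, mul_assoc]
      _ = _ := by rw [hv, mul_smul_comm, smul_smul, ← mul_assoc, mul_comm γ]
  have hleft : u * (u * v * u) = γ • (u * v * u) := by simp [← mul_assoc, huu]
  have hright : u * v * u * u = γ • (u * v * u) := by simp [mul_assoc, huu]
  simp only [sub_mul, mul_sub, smul_mul_assoc, mul_smul_comm, huu, hleft, hright, hmid]
  module

section Antipode

variable {X : Type*} [Fintype X] {S : AssocScheme X 4}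

/-- The opposite `- v` of a vector `v` of a system of frames: a point in relation `R 4` to `x`. -/
noncomputable def antipode (S : AssocScheme X 4) (x : X) : X := (S.exists_rel 4 x).choose

lemma rel_antipode (x : X) : S.R 4 x (S.antipode x) := (S.exists_rel 4 x).choose_spec

namespace IsFrameSystem

variable {f d : ℕ} {s : ℝ} {H K : Matrix X X ℝ} (h : IsFrameSystem S f d s H K)
include h

lemma pos : 0 < s := one_pos.trans h.one_lt

lemma gram_isSymm : H.IsSymm := S.isSymmPartition.isSymm_of_apply h.gram_apply

lemma indicator_isSymm : K.IsSymm := S.isSymmPartition.isSymm_of_apply h.indicator_apply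

lemma gram_self (x : X) : H x x = s := h.gram_apply (S.rel_zero_self x)

lemma indicator_self (x : X) : K x x = 1 := h.indicator_apply (S.rel_zero_self x)

lemma rel_iff_gram {l : Fin 5} {x y : X} : S.R l x y ↔ H x y = gramValue s l := by
  refine ⟨h.gram_apply, fun hxy => ?_⟩
  obtain ⟨l', hl', -⟩ := S.partition x y
  rw [h.gram_apply hl'] at hxy
  exact (gramValue_strictAnti h.one_lt).injective hxy ▸ hl'

lemma indicator_cases (x y : X) : K x y = 0 ∨ K x y = 1 := by
  obtain ⟨l, hl, -⟩ := S.partition x y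
  rw [h.indicator_apply hl]
  fin_cases l <;> simp [sameFrame]

lemma indicator_congr {x y : X} (hxy : K x y = 1) (w : X) : K x w = K y w := by
  have := row_combination_eq_zero h.indicator_isSymm h.indicator_mul (x := x) (y := y) (a := 1)
    (b := -1) (by rw [h.indicator_self, h.indicator_self, hxy]; norm_num) w
  linarith

lemma sum_indicator (x : X) : ∑ y, K x y = 2 * d := by
  have hsq (y : X) : K x y * K y x = K x y := by
    rw [h.indicator_isSymm.apply x y]
    rcases h.indicator_cases x y with hy | hy <;> simp [hy]
  simpa [Matrix.mul_apply, hsq, h.indicator_self] using congr_fun₂ h.indicator_mul x x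

lemma gram_eq_neg {x y : X} (hxy : S.R 4 x y) (w : X) : H y w = -H x w := by
  have hs : H x y = -s := h.gram_apply hxy
  have := row_combination_eq_zero h.gram_isSymm h.gram_mul (x := x) (y := y) (a := 1) (b := 1)
    (by rw [h.gram_self, h.gram_self, hs]; ring) w
  linarith

lemma gram_antipode (x w : X) : H (S.antipode x) w = -H x w := h.gram_eq_neg (rel_antipode x) w

lemma indicator_antipode (x w : X) : K (S.antipode x) w = K x w :=
  (h.indicator_congr (h.indicator_apply (rel_antipode x)) w).symm

lemma eq_antipode {x y : X} (hxy : S.R 4 x y) : y = S.antipode x := by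
  refine (S.diag _ _).1 (h.rel_iff_gram.2 ?_)
  rw [h.gram_eq_neg hxy, h.gram_apply (rel_antipode x)]
  exact neg_neg s

lemma antipode_involutive : Function.Involutive S.antipode := fun x =>
  (h.eq_antipode (S.symm _ _ _ (rel_antipode x))).symm

lemma sum_indicator_mul_gram_mul (x : X) (g : X → ℝ) :
    ∑ y, K x y * H x y * g y = s * (g x - g (S.antipode x)) := by
  classical
  have hterm (y : X) : K x y * H x y * g y =
      s * ((if x = y then g y else 0) - if S.antipode x = y then g y else 0) := by
    obtain ⟨l, hl, -⟩ := S.partition x y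
    have hx : x = y ↔ l = 0 := by
      rw [← S.diag]
      exact ⟨fun h₀ => S.isSymmPartition.unique hl h₀, fun h₀ => h₀ ▸ hl⟩
    have hσ : S.antipode x = y ↔ l = 4 :=
      ⟨fun h₄ => S.isSymmPartition.unique hl (h₄ ▸ rel_antipode x),
        fun h₄ => (h.eq_antipode (h₄ ▸ hl)).symm⟩
    simp only [h.gram_apply hl, h.indicator_apply hl, hx, hσ]
    fin_cases l <;> simp [gramValue, sameFrame]
  simp only [hterm, ← Finset.mul_sum, Finset.sum_sub_distrib, Finset.sum_ite_eq,
    Finset.mem_univ, if_true]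

lemma sq_eq : s ^ 2 = d := by
  obtain ⟨x, -⟩ := S.nonempty 0
  have hterm (y : X) : H x y * H y x = 1 - K x y + K x y * H x y * H x y := by
    rw [h.gram_isSymm.apply x y]
    obtain ⟨l, hl, -⟩ := S.partition x y
    rw [h.gram_apply hl, h.indicator_apply hl]
    fin_cases l <;> simp [gramValue, sameFrame]
  have hdiag := congr_fun₂ h.gram_mul x x
  rw [Matrix.mul_apply, Finset.sum_congr rfl fun y _ => hterm y, Finset.sum_add_distrib,
    Finset.sum_sub_distrib, h.sum_indicator, h.sum_indicator_mul_gram_mul,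
    h.gram_isSymm.apply (S.antipode x) x,
    h.gram_antipode, Matrix.smul_apply, h.gram_self, smul_eq_mul, div_mul_cancel₀ _ h.pos.ne']
    at hdiag
  simp only [Finset.sum_const, Finset.card_univ, nsmul_eq_mul, mul_one] at hdiag
  linarith

lemma frame_tight_of_mem {c x : X} (hx : K c x = 1) (y : X) :
    ∑ u, K c u * H x u * H u y = 2 * s * H x y := by
  simp only [h.indicator_congr hx]
  rw [h.sum_indicator_mul_gram_mul x fun u => H u y, h.gram_antipode]
  ring

lemma frame_tight_diag (c x : X) : ∑ u, K c u * H x u * H u x = 2 * s * s := by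
  rcases h.indicator_cases c x with hx | hx
  · have hterm (u : X) : K c u * H x u * H u x = K c u := by
      rcases h.indicator_cases c u with hu | hu
      · simp [hu]
      · have hxu : K u x = 0 := by rw [← h.indicator_congr hu, hx]
        obtain ⟨l, hl, -⟩ := S.partition u x
        rw [h.gram_isSymm.apply u x, h.gram_apply hl]
        rw [h.indicator_apply hl] at hxu
        fin_cases l <;> simp_all [gramValue, sameFrame]
    rw [Finset.sum_congr rfl fun u _ => hterm u, h.sum_indicator, ← h.sq_eq]
    ring
  · rw [h.frame_tight_of_mem hx, h.gram_self]

lemma frame_tight (c x y : X) : ∑ u, K c u * H x u * H u y = 2 * s * H x y := by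
  classical
  set Δ := Matrix.diagonal (K c)
  set γ : ℝ := Fintype.card X / s
  have hHH : H * H = γ • H := h.gram_mul
  have happly (x y : X) : (H * Δ * H) x y = ∑ u, K c u * H x u * H u y := by
    rw [Matrix.mul_apply]
    exact Finset.sum_congr rfl fun u _ => by rw [Matrix.mul_diagonal, mul_comm (H x u)]
  have hΔ : Δ * (H * Δ * H) = (2 * s) • (Δ * H) := by
    ext x y
    rw [Matrix.diagonal_mul, happly, Matrix.smul_apply, Matrix.diagonal_mul, smul_eq_mul]
    rcases h.indicator_cases c x with hx | hx
    · simp [hx]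
    · rw [h.frame_tight_of_mem hx]
      ring
  have hsymm : ((2 * s) • H - H * Δ * H).IsSymm := by
    simp [Matrix.IsSymm, Δ, h.gram_isSymm.eq, Matrix.mul_assoc]
  have hsq := smul_sub_mul_self_of_mul_eq hHH hΔ
  -- the defect is symmetric and a multiple of an idempotent, so its diagonal decides
  have hzero : (2 * s) • H - H * Δ * H = 0 := eq_zero_of_diag_eq_zero hsymm hsq fun x => by
    rw [Matrix.sub_apply, happly, h.frame_tight_diag, Matrix.smul_apply, h.gram_self, smul_eq_mul,
      sub_self]
  rw [← happly, ← sub_eq_zero.1 hzero, Matrix.smul_apply, smul_eq_mul]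

end IsFrameSystem

end Antipode

/-! ### Mutually unbiased bases in a subconstituent -/

/-- The relations `R 0, …, R 3` on `Y` record the inner products `H x y` between the vectors of a
system of `f - 1` mutually unbiased orthogonal bases of a space of dimension `d`: the vectors have
squared norm `s`, and vectors of different bases have inner product `± 1`. The matrix `K` indicates
which vectors lie in the same basis. -/
structure IsBasisSystem {Y : Type*} [Fintype Y] (R : Fin 4 → Y → Y → Prop) (f d : ℕ) (s : ℝ)
    (H K : Matrix Y Y ℝ) : Prop where
  isSymmPartition : IsSymmPartition R
  one_lt : 1 < s
  sq_eq : s ^ 2 = d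
  three_le : 3 ≤ f
  gram_apply : ∀ {l x y}, R l x y → H x y = gramValue s l.castSucc
  indicator_apply : ∀ {l x y}, R l x y → K x y = sameFrame l.castSucc
  card_eq : Fintype.card Y = (f - 1) * d
  gram_mul : H * H = ((f - 1) * s) • H
  indicator_mul : K * K = (d : ℝ) • K
  gram_mul_indicator : H * K = Matrix.of fun _ _ => s

namespace IsFrameSystem

variable {X : Type*} [Fintype X] {S : AssocScheme X 4} {f d : ℕ} {s : ℝ} {H K : Matrix X X ℝ}
  (h : IsFrameSystem S f d s H K)
include h

lemma exists_rel_iff_rel_one (z : X) {j : Fin 5} (hj : j = 1 ∨ j = 3) :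
    ∃ a, ∀ w, S.R j z w ↔ S.R 1 a w := by
  rcases hj with rfl | rfl
  · exact ⟨z, fun _ => Iff.rfl⟩
  · refine ⟨S.antipode z, fun w => ?_⟩
    rw [h.rel_iff_gram, h.rel_iff_gram, h.gram_antipode]
    exact neg_eq_iff_eq_neg.symm

lemma gram_antipode_right (x w : X) : H x (S.antipode w) = -H x w := by
  rw [h.gram_isSymm.apply, h.gram_antipode, h.gram_isSymm.apply]

variable {z a : X} {j : Fin 5} (ha : ∀ w, S.R j z w ↔ S.R 1 a w)
include ha

lemma indicator_base_mul {y : X} (hy : S.R j z y) (w : X) : K a w * K y w = 0 := by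
  have hay : K a y = 0 := h.indicator_apply ((ha y).1 hy)
  rcases h.indicator_cases a w with hw | hw
  · rw [hw, zero_mul]
  · rw [h.indicator_isSymm.apply w y, ← h.indicator_congr hw, hay, mul_zero]

/-- Exactly one vector of each antipodal pair outside the frame of `a` lies in `R_j(z)`. -/
lemma two_mul_sum_subconstituent {g : X → ℝ} (hg : ∀ w, g (S.antipode w) = g w) :
    2 * ∑ y : S.Subconstituent j z, g y.1 = ∑ w, (1 - K a w) * g w := by
  classical
  set F : X → ℝ := fun w => if H a w = 1 then g w else 0
  have hF : ∑ y : S.Subconstituent j z, g y.1 = ∑ w, F w := by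
    rw [← Finset.sum_filter]
    refine (Finset.sum_subtype _ (fun w => ?_) g).symm
    rw [Finset.mem_filter_univ, ha w, h.rel_iff_gram]
    rfl
  have hflip : ∑ w, F (S.antipode w) = ∑ w, F w :=
    Equiv.sum_comp (h.antipode_involutive.toPerm S.antipode) F
  rw [two_mul, hF]
  nth_rewrite 2 [← hflip]
  rw [← Finset.sum_add_distrib]
  refine Finset.sum_congr rfl fun w _ => ?_
  have hs : s ≠ 1 := h.one_lt.ne'
  have hs' : -s ≠ 1 := by linarith [h.pos]
  obtain ⟨l, hl, -⟩ := S.partition a w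
  simp only [F, h.gram_antipode_right, hg, h.gram_apply hl, h.indicator_apply hl]
  fin_cases l <;> norm_num [gramValue, sameFrame, hs, hs']

lemma card_subconstituent : Fintype.card (S.Subconstituent j z) = (f - 1) * d := by
  have := h.two_mul_sum_subconstituent ha (g := fun _ => 1) fun _ => rfl
  simp only [mul_one, Finset.sum_sub_distrib, h.sum_indicator, Finset.sum_const, Finset.card_univ,
    nsmul_eq_mul, h.card_eq] at this
  rcases f with _ | f
  · exact absurd S.card_pos (by simp [h.card_eq])
  · push_cast at this
    have : (Fintype.card (S.Subconstituent j z) : ℝ) = f * d := by linarith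
    exact_mod_cast this

lemma isSymmPartition_subconstituent :
    IsSymmPartition fun (i : Fin 4) (x y : S.Subconstituent j z) => S.R i.castSucc x.1 y.1 where
  diag x y := (S.diag _ _).trans Subtype.ext_iff.symm
  symm i x y := S.symm _ _ _
  partition x y := by
    obtain ⟨l, hl, hunique⟩ := S.partition x.1 y.1
    have hne : l ≠ Fin.last 4 := by
      rintro rfl
      have hx : H x.1 a = 1 := h.gram_apply (S.symm _ _ _ ((ha x.1).1 x.2))
      have hy : H y.1 a = 1 := h.gram_apply (S.symm _ _ _ ((ha y.1).1 y.2))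
      linarith [h.gram_eq_neg hl a]
    obtain ⟨i, rfl⟩ := Fin.exists_castSucc_eq.2 hne
    exact ⟨i, hl, fun i' hi' => Fin.castSucc_injective _ (hunique _ hi')⟩

lemma gram_mul_subconstituent (x y : S.Subconstituent j z) :
    ∑ w : S.Subconstituent j z, H x.1 w.1 * H w.1 y.1 = (f - 1) * s * H x.1 y.1 := by
  have hs := h.pos.ne'
  have hall : ∑ w, H x.1 w * H w y.1 = 2 * f * s * H x.1 y.1 := by
    have := congr_fun₂ h.gram_mul x.1 y.1
    rw [Matrix.mul_apply, Matrix.smul_apply, smul_eq_mul, h.card_eq] at this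
    rw [this]
    push_cast
    rw [← h.sq_eq]
    field_simp
  have hframe : ∑ w, K a w * (H x.1 w * H w y.1) = 2 * s * H x.1 y.1 := by
    simpa only [mul_assoc] using h.frame_tight a x.1 y.1
  have := h.two_mul_sum_subconstituent ha (g := fun w => H x.1 w * H w y.1) fun w => by
    rw [h.gram_antipode, h.gram_antipode_right, neg_mul_neg]
  simp only [sub_mul, one_mul, Finset.sum_sub_distrib, hall, hframe] at this
  linarith

lemma indicator_mul_subconstituent (x y : S.Subconstituent j z) :
    ∑ w : S.Subconstituent j z, K x.1 w.1 * K w.1 y.1 = d * K x.1 y.1 := by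
  have hall : ∑ w, K x.1 w * K w y.1 = 2 * d * K x.1 y.1 := by
    simpa [Matrix.mul_apply] using congr_fun₂ h.indicator_mul x.1 y.1
  have := h.two_mul_sum_subconstituent ha (g := fun w => K x.1 w * K w y.1) fun w => by
    rw [h.indicator_antipode, h.indicator_isSymm.apply, h.indicator_antipode,
      h.indicator_isSymm.apply]
  simp only [sub_mul, one_mul, ← mul_assoc (K a _), h.indicator_base_mul ha x.2, zero_mul,
    sub_zero, hall] at this
  linarith

lemma gram_mul_indicator_subconstituent (x y : S.Subconstituent j z) :
    ∑ w : S.Subconstituent j z, H x.1 w.1 * K w.1 y.1 = s := by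
  have hbase (w : S.Subconstituent j z) : H a w.1 = 1 := h.gram_apply ((ha w.1).1 w.2)
  have := h.two_mul_sum_subconstituent ha (g := fun w => K y.1 w * H a w * H w x.1) fun w => by
    rw [h.indicator_isSymm.apply, h.indicator_antipode, h.indicator_isSymm.apply, h.gram_antipode,
      h.gram_antipode_right]
    ring
  simp only [sub_mul, one_mul, ← mul_assoc (K a _), h.indicator_base_mul ha y.2, zero_mul,
    sub_zero, h.frame_tight, hbase, mul_one] at this
  simp only [h.gram_isSymm.apply _ x.1, h.indicator_isSymm.apply y.1, mul_comm (H _ _)]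
  linarith

lemma isBasisSystem (hf : 3 ≤ f) :
    IsBasisSystem (fun i (x y : S.Subconstituent j z) => S.R i.castSucc x.1 y.1) f d s
      (Matrix.of fun x y => H x.1 y.1) (Matrix.of fun x y => K x.1 y.1) where
  isSymmPartition := h.isSymmPartition_subconstituent ha
  one_lt := h.one_lt
  sq_eq := h.sq_eq
  three_le := hf
  gram_apply := h.gram_apply
  indicator_apply := h.indicator_apply
  card_eq := h.card_subconstituent ha
  gram_mul := Matrix.ext (h.gram_mul_subconstituent ha)
  indicator_mul := Matrix.ext (h.indicator_mul_subconstituent ha)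
  gram_mul_indicator := Matrix.ext (h.gram_mul_indicator_subconstituent ha)

end IsFrameSystem

/-! ### Spectral decompositions -/

/-- The matrices `E 0, …, E D` are orthogonal idempotents that span the same space as the relation
matrices of a symmetric partition, with mutually inverse (up to the factor `|X|`) eigenmatrices `P`
and `Q`: by `IsSpectralDecomposition.scheme`, such a partition is an association scheme. -/
structure IsSpectralDecomposition {X : Type*} [Fintype X] {D : ℕ} (R : Fin (D + 1) → X → X → Prop)
    (E : Fin (D + 1) → Matrix X X ℝ) (P Q : Matrix (Fin (D + 1)) (Fin (D + 1)) ℝ) : Prop where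
  isSymmPartition : IsSymmPartition R
  mul : ∀ i j, E i * E j = if i = j then E i else 0
  zero : E 0 = Matrix.of fun _ _ => (Fintype.card X : ℝ)⁻¹
  ne_zero : ∀ i, E i ≠ 0
  card_mul_apply : ∀ {l x y}, R l x y → ∀ j, (Fintype.card X : ℝ) * E j x y = Q l j
  eigenmatrix_mul : Q * P = (Fintype.card X : ℝ) • 1

namespace IsSpectralDecomposition

variable {X : Type*} [Fintype X] {D : ℕ} {R : Fin (D + 1) → X → X → Prop}
  {E : Fin (D + 1) → Matrix X X ℝ} {P Q : Matrix (Fin (D + 1)) (Fin (D + 1)) ℝ}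
  (h : IsSpectralDecomposition R E P Q)
include h

lemma card_ne_zero : (Fintype.card X : ℝ) ≠ 0 := by
  intro h₀
  have := Fintype.card_eq_zero_iff.1 (Nat.cast_eq_zero.1 h₀)
  exact h.ne_zero 0 (Subsingleton.elim _ _)

lemma relMatrix_eq (i : Fin (D + 1)) : relMatrix (R i) = ∑ r, P r i • E r := by
  ext x y
  obtain ⟨l, hl, -⟩ := h.isSymmPartition.partition x y
  have hli := congr_fun₂ h.eigenmatrix_mul l i
  simp only [Matrix.mul_apply, ← h.card_mul_apply hl, mul_assoc, ← Finset.mul_sum,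
    Matrix.smul_apply, smul_eq_mul] at hli
  rw [h.isSymmPartition.relMatrix_apply i hl, Matrix.sum_apply]
  simp only [Matrix.smul_apply, smul_eq_mul, mul_comm (P _ i)]
  rw [mul_left_cancel₀ h.card_ne_zero hli, Matrix.one_apply]
  simp only [eq_comm]

lemma relMatrix_mul_relMatrix (i j : Fin (D + 1)) :
    relMatrix (R i) * relMatrix (R j) = ∑ r, (P r i * P r j) • E r := by
  simp only [h.relMatrix_eq, Finset.sum_mul_sum, smul_mul_smul_comm, h.mul,
    smul_ite, smul_zero, Finset.sum_ite_eq, Finset.mem_univ, if_true]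

lemma nonempty (i : Fin (D + 1)) : ∃ x y, R i x y := by
  by_contra! hempty
  have hP (r) : P r i = 0 := by
    have hR : relMatrix (R i) = 0 := by
      ext x y
      simp [relMatrix, hempty]
    have := congrArg (· * E r) (h.relMatrix_eq i)
    simp only [hR, zero_mul, Finset.sum_mul, smul_mul_assoc, h.mul, smul_ite,
      smul_zero, Finset.sum_ite_eq', Finset.mem_univ, if_true] at this
    exact (smul_eq_zero.1 this.symm).resolve_right (h.ne_zero r)
  have := congr_fun₂ h.eigenmatrix_mul i i
  simp only [Matrix.mul_apply, hP, mul_zero, Finset.sum_const_zero, Matrix.smul_apply,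
    Matrix.one_apply_eq, smul_eq_mul, mul_one] at this
  exact h.card_ne_zero this.symm

lemma cast_ncard (i j : Fin (D + 1)) {k : Fin (D + 1)} {x y : X} (hxy : R k x y) :
    ({w | R i x w ∧ R j w y}.ncard : ℝ) =
      (Fintype.card X : ℝ)⁻¹ * ∑ r, P r i * P r j * Q k r := by
  have hcount : ({w | R i x w ∧ R j w y}.ncard : ℝ) =
      (relMatrix (R i) * relMatrix (R j)) x y := by
    rw [cast_ncard_setOf, Matrix.mul_apply]
    refine Finset.sum_congr rfl fun w _ => ?_
    by_cases hi : R i x w <;> by_cases hj : R j w y <;> simp [relMatrix, hi, hj]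
  rw [hcount, h.relMatrix_mul_relMatrix, Matrix.sum_apply, Finset.mul_sum]
  refine Finset.sum_congr rfl fun r _ => ?_
  rw [← h.card_mul_apply hxy, mul_left_comm _ (Fintype.card X : ℝ),
    inv_mul_cancel_left₀ h.card_ne_zero, Matrix.smul_apply, smul_eq_mul]

/-- The association scheme formed by the relations of a spectral decomposition. -/
noncomputable def scheme : AssocScheme X D where
  R := R
  diag := h.isSymmPartition.diag
  partition := h.isSymmPartition.partition
  nonempty := h.nonempty
  symm := h.isSymmPartition.symm
  p i j k := {w | R i (h.nonempty k).choose w ∧ R j w (h.nonempty k).choose_spec.choose}.ncard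
  regular i j k x y hxy := by
    have := (h.cast_ncard i j hxy).trans
      (h.cast_ncard i j (h.nonempty k).choose_spec.choose_spec).symm
    exact_mod_cast this

lemma intersectionMatrix_apply (i j k : Fin (D + 1)) :
    h.scheme.intersectionMatrix i j k = (Fintype.card X : ℝ)⁻¹ * ∑ r, P r i * P r j * Q k r :=
  h.cast_ncard i j (h.nonempty k).choose_spec.choose_spec

/-- The idempotents of a spectral decomposition, as an ordering of the primitive idempotents of its
association scheme. -/
noncomputable def idempotents : h.scheme.Idempotents where
  E := E
  mem j := by
    refine (Submodule.mem_span_range_iff_exists_fun ℝ).2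
      ⟨fun l => (Fintype.card X : ℝ)⁻¹ * Q l j, ?_⟩
    ext x y
    obtain ⟨l, hl, -⟩ := h.isSymmPartition.partition x y
    refine (h.isSymmPartition.sum_smul_relMatrix_apply _ hl).trans ?_
    rw [← h.card_mul_apply hl, inv_mul_cancel_left₀ h.card_ne_zero]
  zero := h.zero
  ne_zero := h.ne_zero
  idem i := (h.mul i i).trans (if_pos rfl)
  orthogonal i j hij := (h.mul i j).trans (if_neg hij)

lemma Q_eq : h.idempotents.Q = Q := by
  ext l j
  obtain ⟨x, y, hl⟩ := h.nonempty l
  rw [← h.idempotents.card_mul_E (S := h.scheme) hl]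
  exact h.card_mul_apply hl j

end IsSpectralDecomposition

/-! ### The scheme of a system of mutually unbiased bases -/

lemma orthogonalIdempotents_of_mul_eq {A : Type*} [Ring A] {z u v : A} (hu : u * u = u)
    (hv : v * v = v) (huv : u * v = z) (hvu : v * u = z) :
    OrthogonalIdempotents ![z, v - z, 1 - u - v + z, u - z] := by
  have huz : u * z = z := by rw [← huv, ← mul_assoc, hu]
  have hzu : z * u = z := by rw [← hvu, mul_assoc, hu]
  have hvz : v * z = z := by rw [← hvu, ← mul_assoc, hv]
  have hzv : z * v = z := by rw [← huv, mul_assoc, hv]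
  have hzz : z * z = z := by nth_rw 1 [← huv]; rw [mul_assoc, hvz, huz]
  rw [OrthogonalIdempotents.iff_mul_eq]
  intro i j
  fin_cases i <;> fin_cases j <;>
    simp [mul_add, add_mul, mul_sub, sub_mul, hu, hv, huv, hvu, huz, hzu, hvz, hzv, hzz]

/-- The second eigenmatrix of a system of `f - 1` mutually unbiased bases in dimension `s ^ 2`. -/
def basisQ (f : ℕ) (s : ℝ) : Matrix (Fin 4) (Fin 4) ℝ :=
  !![1, s ^ 2 - 1, (f - 2) * (s ^ 2 - 1), f - 2;
     1, s - 1, -s + 1, -1;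
     1, -1, -f + 2, f - 2;
     1, -s - 1, s + 1, -1]

/-- The first eigenmatrix of a system of `f - 1` mutually unbiased bases in dimension `s ^ 2`. -/
noncomputable def basisP (f : ℕ) (s : ℝ) : Matrix (Fin 4) (Fin 4) ℝ :=
  !![1, (f - 2) * (s ^ 2 + s) / 2, s ^ 2 - 1, (f - 2) * (s ^ 2 - s) / 2;
     1, (f - 2) * s / 2, -1, -((f - 2) * s / 2);
     1, -(s / 2), -1, s / 2;
     1, -((s ^ 2 + s) / 2), s ^ 2 - 1, -((s ^ 2 - s) / 2)]

lemma basisQ_mul_basisP (f : ℕ) (s : ℝ) :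
    basisQ f s * basisP f s = ((f - 1) * s ^ 2 : ℝ) • (1 : Matrix (Fin 4) (Fin 4) ℝ) := by
  ext i j
  fin_cases i <;> fin_cases j <;>
    simp [basisQ, basisP, Matrix.mul_apply, Fin.sum_univ_four] <;> ring

namespace IsBasisSystem

variable {Y : Type*} [Fintype Y] {R : Fin 4 → Y → Y → Prop} {f d : ℕ} {s : ℝ}
  {H K : Matrix Y Y ℝ} (h : IsBasisSystem R f d s H K)
include h

lemma pos : 0 < s := one_pos.trans h.one_lt

lemma cast_three_le : (3 : ℝ) ≤ f := by exact_mod_cast h.three_le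

lemma cast_card : (Fintype.card Y : ℝ) = (f - 1) * s ^ 2 := by
  rw [h.card_eq, Nat.cast_mul, Nat.cast_pred (by linarith [h.three_le]), h.sq_eq]

lemma cast_card_pos : 0 < (Fintype.card Y : ℝ) := by
  rw [h.cast_card]
  have := h.cast_three_le
  have := h.pos
  exact mul_pos (by linarith) (by positivity)

lemma indicator_mul_gram : K * H = Matrix.of fun _ _ => s := by
  have := congrArg Matrix.transpose h.gram_mul_indicator
  rwa [Matrix.transpose_mul, (h.isSymmPartition.isSymm_of_apply h.gram_apply).eq,
    (h.isSymmPartition.isSymm_of_apply h.indicator_apply).eq] at this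

/-- The idempotents of the algebra spanned by `1`, `J`, `K` and `H`: the averages over all vectors
and over a basis, and the projection onto the ambient space of the vectors, commute. -/
noncomputable def idempotent [DecidableEq Y] (_ : IsBasisSystem R f d s H K) :
    Fin 4 → Matrix Y Y ℝ :=
  let Z := Matrix.of fun _ _ => (Fintype.card Y : ℝ)⁻¹
  let U := (s ^ 2)⁻¹ • K
  let V := ((f - 1) * s)⁻¹ • H
  ![Z, V - Z, 1 - U - V + Z, U - Z]

lemma orthogonalIdempotents [DecidableEq Y] : OrthogonalIdempotents h.idempotent := by
  have hs := h.pos.ne'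
  have hf : (f : ℝ) - 1 ≠ 0 := by linarith [h.cast_three_le]
  apply orthogonalIdempotents_of_mul_eq
  · rw [smul_mul_smul_comm, h.indicator_mul, smul_smul, ← h.sq_eq]
    congr 1
    field_simp
  · rw [smul_mul_smul_comm, h.gram_mul, smul_smul]
    congr 1
    field_simp
  · rw [smul_mul_smul_comm, h.indicator_mul_gram]
    ext
    simp only [h.cast_card, Matrix.smul_apply, Matrix.of_apply, smul_eq_mul]
    field_simp
  · rw [smul_mul_smul_comm, h.gram_mul_indicator]
    ext
    simp only [h.cast_card, Matrix.smul_apply, Matrix.of_apply, smul_eq_mul]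
    field_simp

lemma card_mul_idempotent_apply [DecidableEq Y] {l : Fin 4} {x y : Y} (hl : R l x y) (j : Fin 4) :
    (Fintype.card Y : ℝ) * h.idempotent j x y = basisQ f s l j := by
  have hs := h.pos.ne'
  have hf : (f : ℝ) - 1 ≠ 0 := by linarith [h.cast_three_le]
  have hZ : (Fintype.card Y : ℝ) * (Fintype.card Y : ℝ)⁻¹ = 1 :=
    mul_inv_cancel₀ h.cast_card_pos.ne'
  have hU : (Fintype.card Y : ℝ) * ((s ^ 2)⁻¹ * K x y) = (f - 1) * sameFrame l.castSucc := by
    rw [h.cast_card, h.indicator_apply hl]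
    field_simp
  have hV : (Fintype.card Y : ℝ) * (((f - 1) * s)⁻¹ * H x y) = s * gramValue s l.castSucc := by
    rw [h.cast_card, h.gram_apply hl]
    field_simp
  have hone : (Fintype.card Y : ℝ) * (1 : Matrix Y Y ℝ) x y =
      (f - 1) * s ^ 2 * if 0 = l then 1 else 0 := by
    rw [← h.isSymmPartition.relMatrix_zero, h.isSymmPartition.relMatrix_apply 0 hl, h.cast_card]
  have hE : (Fintype.card Y : ℝ) * h.idempotent j x y =
      ![1, s * gramValue s l.castSucc - 1,
        (f - 1) * s ^ 2 * (if 0 = l then 1 else 0) - (f - 1) * sameFrame l.castSucc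
          - s * gramValue s l.castSucc + 1,
        (f - 1) * sameFrame l.castSucc - 1] j := by
    rw [← hone, ← hU, ← hV]
    fin_cases j <;> simp [idempotent, mul_add, mul_sub, hZ]
  rw [hE]
  fin_cases j <;> fin_cases l <;> simp [gramValue, sameFrame, basisQ] <;> ring

lemma basisQ_zero_pos (j : Fin 4) : 0 < basisQ f s 0 j := by
  have hs : 0 < s ^ 2 - 1 := sub_pos.2 (one_lt_pow₀ h.one_lt two_ne_zero)
  have hf : 0 < (f : ℝ) - 2 := by linarith [h.cast_three_le]
  fin_cases j
  exacts [one_pos, hs, mul_pos hf hs, hf]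

lemma isSpectralDecomposition [DecidableEq Y] :
    IsSpectralDecomposition R h.idempotent (basisP f s) (basisQ f s) where
  isSymmPartition := h.isSymmPartition
  mul i j := h.orthogonalIdempotents.mul_eq i j
  zero := rfl
  ne_zero i hi := by
    obtain ⟨x⟩ : Nonempty Y := Fintype.card_pos_iff.1 (Nat.cast_pos.1 h.cast_card_pos)
    have hx := h.card_mul_idempotent_apply ((h.isSymmPartition.diag x x).2 rfl) i
    rw [hi, Matrix.zero_apply, mul_zero] at hx
    exact (h.basisQ_zero_pos i).ne hx
  card_mul_apply := h.card_mul_idempotent_apply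
  eigenmatrix_mul := by rw [h.cast_card, basisQ_mul_basisP]

lemma intersectionMatrix_eq [DecidableEq Y] {i : Fin 4} {M : Matrix (Fin 4) (Fin 4) ℝ}
    (hM : ∀ j k, ∑ r, basisP f s r i * basisP f s r j * basisQ f s k r =
      (f - 1) * s ^ 2 * M j k) :
    h.isSpectralDecomposition.scheme.intersectionMatrix i = M := by
  ext j k
  rw [h.isSpectralDecomposition.intersectionMatrix_apply, hM, ← h.cast_card,
    inv_mul_cancel_left₀ h.cast_card_pos.ne']

lemma intersectionMatrix_one [DecidableEq Y] :
    h.isSpectralDecomposition.scheme.intersectionMatrix 1 =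
      !![0, 1, 0, 0;
         (f - 2) * (s ^ 2 + s) / 2, (f - 3) * (s ^ 2 + 3 * s) / 4,
           (f - 2) * (s ^ 2 + 2 * s) / 4, (f - 3) * (s ^ 2 + s) / 4;
         0, (s ^ 2 + s - 2) / 2, 0, (s ^ 2 + s) / 2;
         0, (f - 3) * (s ^ 2 - s) / 4, (f - 2) * s ^ 2 / 4, (f - 3) * (s ^ 2 + s) / 4] :=
  h.intersectionMatrix_eq fun j k => by
    fin_cases j <;> fin_cases k <;> simp [basisP, basisQ, Fin.sum_univ_four] <;> ring

lemma intersectionMatrix_two [DecidableEq Y] :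
    h.isSpectralDecomposition.scheme.intersectionMatrix 2 =
      !![0, 0, 1, 0;
         0, (s ^ 2 + s - 2) / 2, 0, (s ^ 2 + s) / 2;
         s ^ 2 - 1, 0, s ^ 2 - 2, 0;
         0, (s ^ 2 - s) / 2, 0, (s ^ 2 - s - 2) / 2] :=
  h.intersectionMatrix_eq fun j k => by
    fin_cases j <;> fin_cases k <;> simp [basisP, basisQ, Fin.sum_univ_four] <;> ring

lemma intersectionMatrix_three [DecidableEq Y] :
    h.isSpectralDecomposition.scheme.intersectionMatrix 3 =
      !![0, 0, 0, 1;
         0, (f - 3) * (s ^ 2 - s) / 4, (f - 2) * s ^ 2 / 4, (f - 3) * (s ^ 2 + s) / 4;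
         0, (s ^ 2 - s) / 2, 0, (s ^ 2 - s - 2) / 2;
         (f - 2) * (s ^ 2 - s) / 2, (f - 3) * (s ^ 2 - s) / 4,
           (f - 2) * (s ^ 2 - 2 * s) / 4, (f - 3) * (s ^ 2 - 3 * s) / 4] :=
  h.intersectionMatrix_eq fun j k => by
    fin_cases j <;> fin_cases k <;> simp [basisP, basisQ, Fin.sum_univ_four] <;> ring

lemma kreinMatrix_one [DecidableEq Y] :
    h.isSpectralDecomposition.idempotents.kreinMatrix 1 =
      !![0, 1, 0, 0;
         s ^ 2 - 1, s ^ 2 / (f - 1) - 2, s ^ 2 / (f - 1), 0;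
         0, (f - 2) * s ^ 2 / (f - 1), (f - 2) * s ^ 2 / (f - 1) - 2, s ^ 2 - 1;
         0, 0, 1, 0] := by
  have hf : (f : ℝ) - 1 ≠ 0 := by linarith [h.cast_three_le]
  ext j k
  refine congr_fun (h.isSpectralDecomposition.idempotents.q_unique fun l => ?_) k
  rw [h.isSpectralDecomposition.Q_eq, Fin.sum_univ_four]
  fin_cases j <;> fin_cases l <;> simp [basisQ] <;> field_simp <;> ring

lemma isQPolynomial [DecidableEq Y] : h.isSpectralDecomposition.idempotents.IsQPolynomial := by
  have hq (j k) := congr_fun₂ h.kreinMatrix_one j k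
  simp only [Idempotents.kreinMatrix, Matrix.of_apply] at hq
  have hs : 0 < s ^ 2 - 1 := sub_pos.2 (one_lt_pow₀ h.one_lt two_ne_zero)
  have hf₁ : (f : ℝ) - 1 ≠ 0 := by linarith [h.cast_three_le]
  apply Idempotents.isQPolynomial_of_q
  · intro j k hjk
    rw [hq]
    fin_cases j <;> fin_cases k <;> simp at hjk ⊢
  · intro j
    rw [hq]
    fin_cases j
    · simp
    · simp [h.pos.ne', hf₁]
    · simpa using hs.ne'

lemma isQAntipodal [DecidableEq Y] : h.isSpectralDecomposition.idempotents.IsQAntipodal := by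
  have hq (j k) := congr_fun₂ h.kreinMatrix_one j k
  simp only [Idempotents.kreinMatrix, Matrix.of_apply] at hq
  intro i hi
  rw [Idempotents.bStar, Idempotents.cStar, hq, hq]
  fin_cases i
  · rfl
  · exact absurd rfl hi
  · rfl

lemma relMatrix_antipodalSetoid [DecidableEq Y] :
    relMatrix h.isSpectralDecomposition.idempotents.antipodalSetoid = K := by
  ext x y
  obtain ⟨l, hl, -⟩ := h.isSymmPartition.partition x y
  have hiff : h.isSpectralDecomposition.idempotents.antipodalSetoid x y ↔
      basisQ f s l 3 = basisQ f s 0 3 := by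
    have := h.isSpectralDecomposition.idempotents.antipodalSetoid_iff hl
    rwa [h.isSpectralDecomposition.Q_eq] at this
  have hf : (-1 : ℝ) ≠ f - 2 := by linarith [h.cast_three_le]
  rw [h.indicator_apply hl, relMatrix, Matrix.of_apply, hiff]
  fin_cases l <;> simp [sameFrame, basisQ, hf]

lemma hasAntipodalClasses [DecidableEq Y] :
    h.isSpectralDecomposition.idempotents.HasAntipodalClasses (f - 1) d := by
  have hd : (d : ℝ) ≠ 0 := h.sq_eq ▸ pow_ne_zero 2 h.pos.ne'
  refine Idempotents.hasAntipodalClasses_of_ncard (Nat.cast_ne_zero.1 hd) (fun x => ?_) h.card_eq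
  have hmul := h.indicator_mul
  rw [← h.relMatrix_antipodalSetoid] at hmul
  exact_mod_cast cast_ncard_class_of_relMatrix_mul hmul x

end IsBasisSystem

end AssocScheme

theorem lemma4p1 {X : Type*} [Fintype X] (S : AssocScheme X 4) (I : S.Idempotents)
    (hpoly : I.IsQPolynomial) (hanti : I.IsQAntipodal) (hbip : I.IsQBipartite)
    -- the relations are numbered in the natural order (decreasing inner products under `E 1`)
    (hnat : ∀ i j : Fin 5, i < j → I.Q j 1 < I.Q i 1)
    (f d : ℕ) (hclasses : I.HasAntipodalClasses f (2 * d)) (hf : 3 ≤ f)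
    (z : X) (j : Fin 5) (hj : j = 1 ∨ j = 3) :
    ∃ T : AssocScheme (S.Subconstituent j z) 3,
      (∀ (i : Fin 4) (x y : S.Subconstituent j z), T.R i x y ↔ S.R i.castSucc x.1 y.1) ∧
      ∃ K : T.Idempotents,
        K.IsQPolynomial ∧ K.IsQAntipodal ∧ K.HasAntipodalClasses (f - 1) d ∧
        K.aStar 1 = (d : ℝ) / ((f : ℝ) - 1) - 2 ∧
        T.intersectionMatrix 1 =
          !![0, 1, 0, 0;
             ((f : ℝ) - 2) * (d + √d) / 2, ((f : ℝ) - 3) * (d + 3 * √d) / 4,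
               ((f : ℝ) - 2) * (d + 2 * √d) / 4, ((f : ℝ) - 3) * (d + √d) / 4;
             0, ((d : ℝ) + √d - 2) / 2, 0, ((d : ℝ) + √d) / 2;
             0, ((f : ℝ) - 3) * (d - √d) / 4, ((f : ℝ) - 2) * d / 4,
               ((f : ℝ) - 3) * (d + √d) / 4] ∧
        T.intersectionMatrix 2 =
          !![0, 0, 1, 0;
             0, ((d : ℝ) + √d - 2) / 2, 0, ((d : ℝ) + √d) / 2;
             (d : ℝ) - 1, 0, (d : ℝ) - 2, 0;
             0, ((d : ℝ) - √d) / 2, 0, ((d : ℝ) - √d - 2) / 2] ∧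
        T.intersectionMatrix 3 =
          !![0, 0, 0, 1;
             0, ((f : ℝ) - 3) * (d - √d) / 4, ((f : ℝ) - 2) * d / 4,
               ((f : ℝ) - 3) * (d + √d) / 4;
             0, ((d : ℝ) - √d) / 2, 0, ((d : ℝ) - √d - 2) / 2;
             ((f : ℝ) - 2) * (d - √d) / 2, ((f : ℝ) - 3) * (d - √d) / 4,
               ((f : ℝ) - 2) * (d - 2 * √d) / 4, ((f : ℝ) - 3) * (d - 3 * √d) / 4] ∧
        K.Q =
          !![1, (d : ℝ) - 1, ((f : ℝ) - 2) * (d - 1), (f : ℝ) - 2;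
             1, √d - 1, -√d + 1, -1;
             1, -1, -(f : ℝ) + 2, (f : ℝ) - 2;
             1, -√d - 1, √d + 1, -1] ∧
        K.kreinMatrix 1 =
          !![0, 1, 0, 0;
             (d : ℝ) - 1, (d : ℝ) / ((f : ℝ) - 1) - 2, (d : ℝ) / ((f : ℝ) - 1), 0;
             0, ((f : ℝ) - 2) * d / ((f : ℝ) - 1), ((f : ℝ) - 2) * d / ((f : ℝ) - 1) - 2,
               (d : ℝ) - 1;
             0, 0, 1, 0] := by
  classical
  obtain ⟨s, H, K, hS⟩ :=
    AssocScheme.Idempotents.exists_isFrameSystem hpoly hanti hbip (fun i j => hnat i j) hclasses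
  obtain ⟨a, ha⟩ := hS.exists_rel_iff_rel_one z hj
  have hB := hS.isBasisSystem ha hf
  have hE := hB.isSpectralDecomposition
  simp only [← hS.sq_eq, Real.sqrt_sq hS.pos.le]
  exact ⟨hE.scheme, fun _ _ _ => Iff.rfl, hE.idempotents, hB.isQPolynomial, hB.isQAntipodal,
    hB.hasAntipodalClasses, congr_fun₂ hB.kreinMatrix_one 1 1, hB.intersectionMatrix_one,
    hB.intersectionMatrix_two, hB.intersectionMatrix_three, hE.Q_eq, hB.kreinMatrix_one⟩
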